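/- **Setting.** Let $0<T_1<T_2$, $t_0\in[0,T_1]$, and let $(\Omega,\mathcal F,\mathbb F=(\mathcal F_t)_{t\ge0},\mathbb P_0)$ be a filtered probability space (for instance with $\Omega=C([0,T_2];\mathbb R^2)$). On $[t_0,T_2]$ let $(X_t,Y_t)$ be adapted, almost surely continuous, and solve $$dX_t=X_t\tilde\sigma(Y_t)\,dW_t,\qquad dY_t=b(X_t,Y_t)\,dt+\tau_1(X_t,Y_t)\,dW_t+\tau_2(X_t,Y_t)\,dW^\perp_t,\qquad (X_{t_0},Y_{t_0})=(x,y),$$ where $x,y>0$ are constants and $(W,W^\perp)$ is a two-dimensional $(\mathbb F,\mathbb P_0)$-Brownian motion. Assume: * (A3) $\tilde\sigma:\mathbb R\to\mathbb R$ is Lipschitz; $b,\tau_1,\tau_2:\mathbb R^2\to\mathbb R$ are $C^2$ and Lipschitz; $|Db|+|D\tau_2|\le\lambda_0|\tau_2|$ on $\mathbb R^2$ for some $\lambda_0>0$; and $|\tau_1(x,y)|+|\tau_2(x,y)|+|b(x,y)|\le C(1+|y|)$ for all $x,y$ and some constant $C$. * (A4) $\tilde\sigma$ is bounded and $(x,y)\mapsto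 b(e^x,y)$ is Lipschitz. Let $\mu_1,\mu_2,\mu_3$ be Borel probability measures on $\mathbb R$ with finite second moments, with $\mu_3$ carried by $[0,\infty)$, $\mu_1\le_c\mu_2$ (i.e. $\int h\,d\mu_1\le\int h\,d\mu_2$ for every convex $h:\mathbb R\to\mathbb R$) and $\int_{(0,\infty)}(\log z)^2\,d(\mu_1+\mu_2)(z)<\infty$. Let $\mathcal C_{t_0}(\mu_1,\mu_2)$ be the set of probability measures $\mathbb P$ on $(\Omega,\mathcal F)$ such that $(X_t)_{t\in[t_0,T_2]}$ is an $((\mathcal F_t),\mathbb P)$-martingale, $\mathcal L^{\mathbb P}(X_{T_2})=\mu_2$ and, if $t_0<T_1$, $\mathcal L^{\mathbb P}(X_{T_1})=\mu_1$. Let $\mathrm{VIX}'$ be the set of probability measures $\mathbb P$ on $(\Omega,\mathcal F)$ for which $$V_{\mathbb P}=\mathbb E^{\mathbb P}\big[-\log X_{T_2}+\log X_{T_1}\,\big|\,\mathcal F_{T_1}\big]$$ is well defined (that is, $X_{T_1},X_{T_2}>0$ $\mathbb P$-a.s. and $-\log X_{T_2}+\log X_{T_1}$ is $\mathbb P$-integrable)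 and $\mathcal L^{\mathbb P}(V_{\mathbb P})\le_{c,l}\mu_3$. Here, for probability measures $\mu,\nu$ carried by $[0,\infty)$, $\mu\le_{c,l}\nu$ means $\int h\,d\mu\le\int h\,d\nu$ for every convex $h:[0,\infty)\to\mathbb R$ that is bounded below. Let $H(\mathbb P|\mathbb P_0)=\int\log\frac{d\mathbb P}{d\mathbb P_0}\,d\mathbb P$ if $\mathbb P\ll\mathbb P_0$ and $H(\mathbb P|\mathbb P_0)=+\infty$ otherwise, and set $$D'_{\mathbb P_0}=\inf_{\mathbb P\in\mathcal C_{t_0}(\mu_1,\mu_2)\cap\mathrm{VIX}'}H(\mathbb P|\mathbb P_0).$$ **Proposition 4.2.** If the problem is admissible, i.e. $\mathcal C_{t_0}(\mu_1,\mu_2)\cap\mathrm{VIX}'\ne\emptyset$, then it has a minimiser: there is $\mathbb P^*\in\mathcal C_{t_0}(\mu_1,\mu_2)$ with $\mathcal L^{\mathbb P^*}(V_{\mathbb P^*})\le_{c,l}\mu_3$, $V_{\mathbb P^*}$ being well defined in the above sense, and $H(\mathbb P^*|\mathbb P_0)=D'_{\mathbb P_0}$. -/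

import Mathlib

open MeasureTheory ProbabilityTheory InformationTheory Set Filter
open scoped NNReal ENNReal

namespace SchroedingerBridge

/-! ### Convex orders -/

/-- The convex order `μ ≤_c ν` on measures with finite first moment: `∫ h ∂μ ≤ ∫ h ∂ν` for every
convex `h : ℝ → ℝ`. Both integrals are well defined in `(-∞, ∞]`, since `h` is bounded below by an
affine function. The inequality is void if `∫ h ∂ν = ∞`; otherwise it says that `h` is also
`μ`-integrable and that the two (finite) integrals are ordered. -/
def ConvexOrder (μ ν : Measure ℝ) : Prop :=
  ∀ h : ℝ → ℝ, ConvexOn ℝ univ h → Integrable h ν →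
    Integrable h μ ∧ ∫ x, h x ∂μ ≤ ∫ x, h x ∂ν

/-- The order `μ ≤_{c,l} ν` on probability measures carried by `[0, ∞)`: `∫ h ∂μ ≤ ∫ h ∂ν` in
`(-∞, ∞]` for every convex `h : [0, ∞) → ℝ` that is bounded below. The lower bound `c` is
subtracted on both sides (the measures are probabilities), so that both integrals are integrals of
nonnegative functions, with values in `[0, ∞]`. -/
def ConvexOrderLB (μ ν : Measure ℝ) : Prop :=
  μ (Iio 0) = 0 ∧ ν (Iio 0) = 0 ∧
  ∀ (h : ℝ → ℝ) (c : ℝ), ConvexOn ℝ (Ici 0) h → (∀ x ∈ Ici (0 : ℝ), c ≤ h x) →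
    ∫⁻ x in Ici 0, ENNReal.ofReal (h x - c) ∂μ ≤ ∫⁻ x in Ici 0, ENNReal.ofReal (h x - c) ∂ν

/-! ### The coefficients -/

/-- Assumption (A3), for `σ(x, y) = x * σt y`. Gradients on `ℝ²` are Fréchet derivatives; the
choice of the norm on `ℝ²` only affects the constants. -/
structure AssumptionA3 (σt : ℝ → ℝ) (b τ₁ τ₂ : ℝ × ℝ → ℝ) : Prop where
  lipschitz_σt : ∃ K, LipschitzWith K σt
  contDiff_b : ContDiff ℝ 2 b
  contDiff_τ₁ : ContDiff ℝ 2 τ₁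
  contDiff_τ₂ : ContDiff ℝ 2 τ₂
  lipschitz_b : ∃ K, LipschitzWith K b
  lipschitz_τ₁ : ∃ K, LipschitzWith K τ₁
  lipschitz_τ₂ : ∃ K, LipschitzWith K τ₂
  gradient_bound : ∃ l : ℝ, 0 < l ∧ ∀ z, ‖fderiv ℝ b z‖ + ‖fderiv ℝ τ₂ z‖ ≤ l * |τ₂ z|
  growth : ∃ C : ℝ, ∀ x y, |τ₁ (x, y)| + |τ₂ (x, y)| + |b (x, y)| ≤ C * (1 + |y|)

/-- Assumption (A4). -/
structure AssumptionA4 (σt : ℝ → ℝ) (b : ℝ × ℝ → ℝ) : Prop where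
  bounded_σt : ∃ M : ℝ, ∀ y, |σt y| ≤ M
  lipschitz_b_exp : ∃ K, LipschitzWith K (fun z : ℝ × ℝ => b (Real.exp z.1, z.2))

/-! ### The stochastic volatility model

Processes are families `ℝ≥0 → Ω → ℝ`; only their values at times in a compact interval matter. -/

variable {Ω : Type*} [mΩ : MeasurableSpace Ω]

/-- `(W, W')` is, on the time interval `[a, b]`, a two-dimensional Brownian motion with respect to
the filtration `𝓕` under `P` (the value at the initial time `a` is irrelevant): it is adapted and
almost surely continuous, and, for `s ≤ t`, its increment from `s` to `t` is independent of `𝓕 s`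
and has two independent centred Gaussian components of variance `t - s`. -/
structure IsBrownianPairOn (𝓕 : Filtration ℝ≥0 mΩ) (P : Measure Ω) (W W' : ℝ≥0 → Ω → ℝ)
    (a b : ℝ≥0) : Prop where
  adapted : ∀ t ∈ Icc a b, StronglyMeasurable[𝓕 t] (W t) ∧ StronglyMeasurable[𝓕 t] (W' t)
  continuous : ∀ᵐ ω ∂P, ContinuousOn (fun t => W t ω) (Icc a b) ∧
    ContinuousOn (fun t => W' t ω) (Icc a b)
  law : ∀ s t, a ≤ s → s ≤ t → t ≤ b →
    HasLaw (fun ω => (W t ω - W s ω, W' t ω - W' s ω))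
      ((gaussianReal 0 (t - s)).prod (gaussianReal 0 (t - s))) P
  indep : ∀ s t, a ≤ s → s ≤ t → t ≤ b →
    Indep (MeasurableSpace.comap (fun ω => (W t ω - W s ω, W' t ω - W' s ω)) inferInstance)
      (𝓕 s) P

/-- The `k`-th of the points that divide `[a, t]` into `n` intervals of equal length. -/
noncomputable def gridPoint (a t : ℝ≥0) (n k : ℕ) : ℝ≥0 := a + (k / n) * (t - a)

/-- `I` is the Itô integral `∫_a^t H dW`, for integrands with continuous paths: the limit in
probability of the Riemann sums with the integrand taken at left end points. -/
def IsItoIntegral (P : Measure Ω) (H W : ℝ≥0 → Ω → ℝ) (a t : ℝ≥0) (I : Ω → ℝ) : Prop :=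
  TendstoInMeasure P
    (fun (n : ℕ) ω => ∑ k ∈ Finset.range n, H (gridPoint a t n k) ω *
      (W (gridPoint a t n (k + 1)) ω - W (gridPoint a t n k) ω)) atTop I

/-- On `[t₀, T]`, the processes `X, Y` are adapted, have almost surely continuous paths, and solve
`dX = X σt(Y) dW`, `dY = b(X, Y) dt + τ₁(X, Y) dW + τ₂(X, Y) dW'` with `X_{t₀} = x`, `Y_{t₀} = y`,
where `(W, W')` is a two-dimensional Brownian motion with respect to `𝓕` under `P`. -/
structure SolvesSVM (𝓕 : Filtration ℝ≥0 mΩ) (P : Measure Ω)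
    (σt : ℝ → ℝ) (b τ₁ τ₂ : ℝ × ℝ → ℝ) (W W' X Y : ℝ≥0 → Ω → ℝ)
    (t₀ T : ℝ≥0) (x y : ℝ) : Prop where
  brownian : IsBrownianPairOn 𝓕 P W W' t₀ T
  adapted : ∀ t ∈ Icc t₀ T, StronglyMeasurable[𝓕 t] (X t) ∧ StronglyMeasurable[𝓕 t] (Y t)
  continuous : ∀ᵐ ω ∂P, ContinuousOn (fun t => X t ω) (Icc t₀ T) ∧
    ContinuousOn (fun t => Y t ω) (Icc t₀ T)
  initial : ∀ᵐ ω ∂P, X t₀ ω = x ∧ Y t₀ ω = y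
  sde : ∃ I J K : ℝ≥0 → Ω → ℝ, ∀ t ∈ Icc t₀ T,
    IsItoIntegral P (fun s ω => X s ω * σt (Y s ω)) W t₀ t (I t) ∧
    IsItoIntegral P (fun s ω => τ₁ (X s ω, Y s ω)) W t₀ t (J t) ∧
    IsItoIntegral P (fun s ω => τ₂ (X s ω, Y s ω)) W' t₀ t (K t) ∧
    ∀ᵐ ω ∂P, X t ω = x + I t ω ∧
      Y t ω = y + (∫ s in (t₀ : ℝ)..t, b (X s.toNNReal ω, Y s.toNNReal ω)) + J t ω + K t ω

/-! ### The minimisation problem -/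

/-- The restriction of a filtration to the times in `[a, b]`. -/
def restrictIcc (𝓕 : Filtration ℝ≥0 mΩ) (a b : ℝ≥0) : Filtration (Icc a b) mΩ where
  seq t := 𝓕 t
  mono' _ _ hst := 𝓕.mono hst
  le' t := 𝓕.le t

/-- The set `𝓒_{t₀}(μ₁, μ₂)` of the probability measures `P` on `Ω` under which
`(X_t)_{t ∈ [t₀, T₂]}` is a martingale, `X_{T₂}` has law `μ₂` and, if `t₀ < T₁`, `X_{T₁}` has law
`μ₁`. -/
def calibrated (𝓕 : Filtration ℝ≥0 mΩ) (X : ℝ≥0 → Ω → ℝ) (t₀ T₁ T₂ : ℝ≥0)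
    (μ₁ μ₂ : Measure ℝ) : Set (Measure Ω) :=
  {P | IsProbabilityMeasure P ∧
    (t₀ < T₁ → HasLaw (X T₁) μ₁ P) ∧ HasLaw (X T₂) μ₂ P ∧
    Martingale (fun t : Icc t₀ T₂ => X t) (restrictIcc 𝓕 t₀ T₂) P}

/-- The random variable `V_P = E^P[-log X_{T₂} + log X_{T₁} | 𝓕_{T₁}]`. -/
noncomputable def vixVariable (𝓕 : Filtration ℝ≥0 mΩ) (X : ℝ≥0 → Ω → ℝ) (T₁ T₂ : ℝ≥0)
    (P : Measure Ω) : Ω → ℝ :=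
  P[fun ω => -Real.log (X T₂ ω) + Real.log (X T₁ ω) | 𝓕 T₁]

/-- The set `VIX'` of the measures `P` for which the law of `V_P` is dominated by `μ₃` in the order
`≤_{c,l}`. The first two conjuncts only say that `V_P` makes sense: the logarithms are those of
`P`-almost surely positive numbers, and the conditional expectation is that of an integrable random
variable. -/
def vixConstraint (𝓕 : Filtration ℝ≥0 mΩ) (X : ℝ≥0 → Ω → ℝ) (T₁ T₂ : ℝ≥0)
    (μ₃ : Measure ℝ) : Set (Measure Ω) :=
  {P | (∀ᵐ ω ∂P, 0 < X T₁ ω ∧ 0 < X T₂ ω) ∧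
    Integrable (fun ω => -Real.log (X T₂ ω) + Real.log (X T₁ ω)) P ∧
    ConvexOrderLB (P.map (vixVariable 𝓕 X T₁ T₂ P)) μ₃}

/-- The value `D'` of the relaxed problem: the infimum of the relative entropy `H(P | P₀)` over
`𝓒_{t₀}(μ₁, μ₂) ∩ VIX'`. Between probability measures, `klDiv P P₀` is `∫ log (dP/dP₀) dP` if
`P ≪ P₀`, and `∞` otherwise. -/
noncomputable def relaxedValue (𝓕 : Filtration ℝ≥0 mΩ) (P₀ : Measure Ω) (X : ℝ≥0 → Ω → ℝ)
    (t₀ T₁ T₂ : ℝ≥0) (μ₁ μ₂ μ₃ : Measure ℝ) : ℝ≥0∞ :=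
  ⨅ P ∈ calibrated 𝓕 X t₀ T₁ T₂ μ₁ μ₂ ∩ vixConstraint 𝓕 X T₁ T₂ μ₃, klDiv P P₀

end SchroedingerBridge

open SchroedingerBridge

/-! ### Quantitative convexity of the entropy and passage to the limit in moments -/

namespace SchroedingerBridge

open scoped Topology

/-! Both constraint sets can be expressed by conditions `∫ |G|² ≤ M`, `∫ G ≤ c`, linear in the
measure. Let `𝓜` be the admissible measures of finite entropy, and enlarge it to all `P ≪ P₀`
obeying every such condition valid on `𝓜` (`SatisfiesMoments`). The enlarged set is convex. A
midpoint inequality for the entropy with an `L¹` remainder makes the densities of a minimising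
sequence Cauchy in `L¹`. The second-moment bounds carry the conditions to the limit `Q`, and Fatou
gives minimality (`exists_entropic_projection`).

It remains to see that `Q` is itself admissible. Laws are tested by indicators, and the martingale
property by increments on past events. For the VIX constraint, `V_P` depends nonlinearly on `P`, but
`≤_{c,l}` only needs finite maxima of affine functions (`convexOrderLB_of_affineMax`). Choose for
`V_Q` the index `τ` of the maximal function. It is `𝓕_{T₁}`-measurable, so the expected maximum at
`V_Q` equals `E^Q[a_τ + b_τ L]`, where `L` is the log-return defining `V`. With `τ` fixed, this is a
linear moment, and under each `P` in `𝓜` it is at most the expected maximum at `V_P`, which is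
controlled by `μ₃` (`SatisfiesMoments.convexOrderLB_condExp`). -/

lemma mul_log_ge_of_nonneg {a m : ℝ} (ha : 0 ≤ a) (hm : 0 ≤ m) (h : m = 0 → a = 0) :
    a * Real.log m + 2 * a - 2 * (√a * √m) ≤ a * Real.log a := by
  rcases ha.eq_or_lt with rfl | ha
  · simp
  have hm' : 0 < m := hm.lt_of_ne fun h0 => ha.ne' (h h0.symm)
  have hsa := Real.sqrt_pos.2 ha
  have hsm := Real.sqrt_pos.2 hm'
  -- `log t ≤ t - 1` at `t = √(m/a)`, then multiplied by `2a`. The square root produces a squared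
  -- Hellinger distance below.
  have h1 := Real.log_le_sub_one_of_pos (div_pos hsm hsa)
  rw [Real.log_div hsm.ne' hsa.ne', Real.log_sqrt hm, Real.log_sqrt ha.le] at h1
  have h2 : a * (√m / √a) = √a * √m := by
    have := Real.sq_sqrt ha.le
    field_simp
    linarith
  nlinarith [mul_le_mul_of_nonneg_left h1 ha.le]

/-- The convexity defect at the midpoint is at least `(√a - √b)² / 2`. Since `|a - b| = |√a - √b|
(√a + √b)`, Young's inequality with parameter `δ` turns this into a bound on `|a - b|`. -/
lemma two_mul_klFun_midpoint_add_le {a b δ : ℝ} (ha : 0 ≤ a) (hb : 0 ≤ b) :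
    2 * klFun ((a + b) / 2) + δ * |a - b| ≤ klFun a + klFun b + δ ^ 2 * (a + b) := by
  set m := (a + b) / 2 with hm
  have hm0 : 0 ≤ m := by positivity
  have h1 := mul_log_ge_of_nonneg ha hm0 fun h => by linarith
  have h2 := mul_log_ge_of_nonneg hb hm0 fun h => by linarith
  have hu := Real.sq_sqrt ha
  have hv := Real.sq_sqrt hb
  have hw := Real.sq_sqrt hm0
  have hu0 := Real.sqrt_nonneg a
  have hv0 := Real.sqrt_nonneg b
  have hw0 := Real.sqrt_nonneg m
  set u := √a
  set v := √b
  set w := √m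
  have key : a * Real.log m + b * Real.log m = 2 * (m * Real.log m) := by rw [hm]; ring
  have h3 : (u - v) ^ 2 / 2 ≤ (u - w) ^ 2 + (v - w) ^ 2 := by nlinarith [sq_nonneg (u + v - 2 * w)]
  have h4 : δ * |a - b| ≤ (u - v) ^ 2 / 2 + δ ^ 2 * (a + b) := by
    have : |a - b| = |u - v| * (u + v) := by
      rw [← hu, ← hv, sq_sub_sq, abs_mul, abs_of_nonneg (add_nonneg hu0 hv0), mul_comm]
    rw [this, ← sq_abs (u - v)]
    nlinarith [sq_nonneg (|u - v| - δ * (u + v)), mul_nonneg (sq_nonneg δ) (sq_nonneg (u - v))]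
  simp only [klFun_apply]
  nlinarith

/-- The truncation of a function at the levels `±K`. -/
noncomputable def truncAt {Ω : Type*} (G : Ω → ℝ) (K : ℝ) (ω : Ω) : ℝ := max (-K) (min K (G ω))

lemma abs_truncAt_le {Ω : Type*} (G : Ω → ℝ) {K : ℝ} (hK : 0 ≤ K) (ω : Ω) : |truncAt G K ω| ≤ K := by
  unfold truncAt
  rw [abs_le]
  exact ⟨le_max_left _ _, max_le (by linarith) (min_le_left _ _)⟩

lemma abs_sub_truncAt_le {Ω : Type*} (G : Ω → ℝ) {K : ℝ} (hK : 0 < K) (ω : Ω) :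
    |G ω - truncAt G K ω| ≤ G ω ^ 2 / K := by
  rw [le_div_iff₀ hK]
  unfold truncAt
  rcases le_total (G ω) K with h | h
  · rw [min_eq_right h]
    rcases le_total (-K) (G ω) with h' | h'
    · rw [max_eq_right h']; simp; positivity
    · rw [max_eq_left h', abs_of_nonpos (by linarith)]; nlinarith
  · rw [min_eq_left h, max_eq_right (by linarith), abs_of_nonneg (by linarith)]; nlinarith

variable {Ω : Type*} [mΩ : MeasurableSpace Ω]

lemma two_mul_klDiv_midpoint_add_le {P₀ P Q : Measure Ω} [IsProbabilityMeasure P₀]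
    [IsProbabilityMeasure P] [IsProbabilityMeasure Q] (hP : P ≪ P₀) (hQ : Q ≪ P₀) (δ : ℝ≥0) :
    2 * klDiv ((2⁻¹ : ℝ≥0) • (P + Q)) P₀ +
      δ * eLpNorm ((fun ω => (P.rnDeriv P₀ ω).toReal) - fun ω => (Q.rnDeriv P₀ ω).toReal) 1 P₀ ≤
    klDiv P P₀ + klDiv Q P₀ + 2 * δ ^ 2 := by
  have hR : (2⁻¹ : ℝ≥0) • (P + Q) ≪ P₀ := (hP.add_left hQ).smul_left _
  rw [klDiv_eq_lintegral_klFun_of_ac hR, klDiv_eq_lintegral_klFun_of_ac hP,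
    klDiv_eq_lintegral_klFun_of_ac hQ, eLpNorm_one_eq_lintegral_enorm,
    ← lintegral_const_mul _ (by fun_prop), ← lintegral_const_mul _ (by fun_prop),
    ← lintegral_add_left (by fun_prop), ← lintegral_add_left (by fun_prop)]
  -- The two densities have total mass `2`, so the pointwise error `δ² (p + q)` integrates to a
  -- constant.
  have hmass : (2 : ℝ≥0∞) * δ ^ 2 = ∫⁻ ω, δ ^ 2 * (P.rnDeriv P₀ ω + Q.rnDeriv P₀ ω) ∂P₀ := by
    rw [lintegral_const_mul _ (by fun_prop), lintegral_add_left (by fun_prop),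
      Measure.lintegral_rnDeriv hP, Measure.lintegral_rnDeriv hQ]
    simp only [measure_univ]
    rw [one_add_one_eq_two, mul_comm]
  rw [hmass, ← lintegral_add_left (by fun_prop)]
  refine lintegral_mono_ae ?_
  filter_upwards [Measure.rnDeriv_smul_left (P + Q) P₀ 2⁻¹, Measure.rnDeriv_add P Q P₀,
    P.rnDeriv_lt_top P₀, Q.rnDeriv_lt_top P₀] with ω h1 h2 h3 h4
  have h5 : (((2⁻¹ : ℝ≥0) • (P + Q)).rnDeriv P₀ ω).toReal =
      ((P.rnDeriv P₀ ω).toReal + (Q.rnDeriv P₀ ω).toReal) / 2 := by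
    rw [h1, Pi.smul_apply, h2, Pi.add_apply, ENNReal.smul_def, smul_eq_mul, ENNReal.toReal_mul,
      ENNReal.toReal_add h3.ne h4.ne]
    simp
    ring
  rw [h5]
  have h6 : P.rnDeriv P₀ ω + Q.rnDeriv P₀ ω =
      ENNReal.ofReal ((P.rnDeriv P₀ ω).toReal + (Q.rnDeriv P₀ ω).toReal) := by
    rw [← ENNReal.toReal_add h3.ne h4.ne, ENNReal.ofReal_toReal (by simp [h3.ne, h4.ne])]
  rw [h6]
  set p := (P.rnDeriv P₀ ω).toReal with hp
  set q := (Q.rnDeriv P₀ ω).toReal with hq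
  have hp0 : 0 ≤ p := ENNReal.toReal_nonneg
  have hq0 : 0 ≤ q := ENNReal.toReal_nonneg
  have hkp := klFun_nonneg hp0
  have hkq := klFun_nonneg hq0
  have hkm := klFun_nonneg (show 0 ≤ (p + q) / 2 by positivity)
  have e1 : (δ : ℝ≥0∞) = ENNReal.ofReal δ := by simp
  rw [Pi.sub_apply, Real.enorm_eq_ofReal_abs, e1, ← ENNReal.ofReal_ofNat 2,
    ← ENNReal.ofReal_mul (by norm_num), ← ENNReal.ofReal_mul (by positivity),
    ← ENNReal.ofReal_add (by positivity) (by positivity), ← ENNReal.ofReal_pow (by positivity),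
    ← ENNReal.ofReal_mul (by positivity), ← ENNReal.ofReal_add hkp hkq,
    ← ENNReal.ofReal_add (by positivity) (by positivity)]
  exact ENNReal.ofReal_le_ofReal (two_mul_klFun_midpoint_add_le hp0 hq0)

lemma memLp_two_of_lintegral_le {P : Measure Ω} {G : Ω → ℝ} (hG : AEStronglyMeasurable G P)
    {M : ℝ≥0∞} (hM : M ≠ ∞) (h : ∫⁻ ω, ‖G ω‖ₑ ^ 2 ∂P ≤ M) : MemLp G 2 P := by
  refine ⟨hG, ?_⟩
  rw [eLpNorm_lt_top_iff_lintegral_rpow_enorm_lt_top (by norm_num) (by norm_num)]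
  simpa using h.trans_lt hM.lt_top

lemma measurable_truncAt {G : Ω → ℝ} (hG : Measurable G) (K : ℝ) : Measurable (truncAt G K) := by
  unfold truncAt; fun_prop

lemma abs_integral_sub_truncAt_le {P : Measure Ω} [IsProbabilityMeasure P] {G : Ω → ℝ}
    (hG : Measurable G) {M : ℝ≥0∞} (hM : M ≠ ∞) (h : ∫⁻ ω, ‖G ω‖ₑ ^ 2 ∂P ≤ M) {K : ℝ}
    (hK : 0 < K) : |∫ ω, G ω ∂P - ∫ ω, truncAt G K ω ∂P| ≤ M.toReal / K := by
  have hmem := memLp_two_of_lintegral_le hG.aestronglyMeasurable hM h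
  have hint : Integrable (truncAt G K) P :=
    Integrable.of_bound (measurable_truncAt hG K).aestronglyMeasurable K
      (ae_of_all _ fun ω => abs_truncAt_le G hK.le ω)
  have hGi : Integrable G P := hmem.integrable (by norm_num)
  rw [← integral_sub hGi hint]
  refine (abs_integral_le_integral_abs).trans ?_
  have hsq : Integrable (fun ω => G ω ^ 2) P := hmem.integrable_sq
  calc ∫ ω, |G ω - truncAt G K ω| ∂P ≤ ∫ ω, G ω ^ 2 / K ∂P :=
        integral_mono (hGi.sub hint).abs (hsq.div_const K) fun ω => abs_sub_truncAt_le G hK ω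
    _ = (∫ ω, G ω ^ 2 ∂P) / K := integral_div _ _
    _ ≤ M.toReal / K := by
        gcongr
        rw [integral_eq_lintegral_of_nonneg_ae (ae_of_all _ fun ω => sq_nonneg _)
          hsq.aestronglyMeasurable]
        refine ENNReal.toReal_mono hM (le_of_eq_of_le ?_ h)
        refine lintegral_congr fun ω => ?_
        rw [Real.enorm_eq_ofReal_abs, ← ENNReal.ofReal_pow (abs_nonneg _), sq_abs]

/-- Moment constraints with uniformly bounded second moments are preserved by convergence of
probability measures against bounded measurable functions. -/
lemma moment_constraint_of_tendsto {P : ℕ → Measure Ω} {Q : Measure Ω}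
    [∀ n, IsProbabilityMeasure (P n)] [IsProbabilityMeasure Q]
    (hconv : ∀ f : Ω → ℝ, Measurable f → (∃ C, ∀ ω, |f ω| ≤ C) →
      Tendsto (fun n => ∫ ω, f ω ∂P n) atTop (𝓝 (∫ ω, f ω ∂Q)))
    {G : Ω → ℝ} (hG : Measurable G) {M : ℝ≥0∞} (hM : M ≠ ∞) {c : ℝ}
    (h : ∀ n, ∫⁻ ω, ‖G ω‖ₑ ^ 2 ∂P n ≤ M ∧ ∫ ω, G ω ∂P n ≤ c) :
    ∫⁻ ω, ‖G ω‖ₑ ^ 2 ∂Q ≤ M ∧ ∫ ω, G ω ∂Q ≤ c := by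
  -- Bounded test functions `min (G²) K` pass to the limit in `n`; then `K → ∞` by monotone
  -- convergence.
  have hsq : ∫⁻ ω, ‖G ω‖ₑ ^ 2 ∂Q ≤ M := by
    have hmeas : ∀ K : ℕ, Measurable fun ω => min (G ω ^ 2) (K : ℝ) := fun K => by fun_prop
    have hb : ∀ (K : ℕ) ω, |min (G ω ^ 2) (K : ℝ)| ≤ K := fun K ω => by
      rw [abs_of_nonneg (by positivity)]; exact min_le_right _ _
    have hlint : ∀ (K : ℕ) (P' : Measure Ω) [IsProbabilityMeasure P'],
        ∫⁻ ω, ENNReal.ofReal (min (G ω ^ 2) (K : ℝ)) ∂P' =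
          ENNReal.ofReal (∫ ω, min (G ω ^ 2) (K : ℝ) ∂P') := fun K P' _ => by
      rw [ofReal_integral_eq_lintegral_ofReal _ (ae_of_all _ fun ω => by positivity)]
      exact Integrable.of_bound (hmeas K).aestronglyMeasurable K (ae_of_all _ (hb K))
    have hbd : ∀ K : ℕ, ∫⁻ ω, ENNReal.ofReal (min (G ω ^ 2) (K : ℝ)) ∂Q ≤ M := fun K => by
      rw [hlint K Q]
      refine le_of_tendsto (ENNReal.tendsto_ofReal (hconv _ (hmeas K) ⟨K, hb K⟩))
        (Eventually.of_forall fun n => ?_)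
      rw [← hlint K (P n)]
      refine (lintegral_mono fun ω => ?_).trans (h n).1
      rw [Real.enorm_eq_ofReal_abs, ← ENNReal.ofReal_pow (abs_nonneg _), sq_abs]
      exact ENNReal.ofReal_le_ofReal (min_le_left _ _)
    refine le_of_tendsto (lintegral_tendsto_of_tendsto_of_monotone
      (f := fun (K : ℕ) ω => ENNReal.ofReal (min (G ω ^ 2) (K : ℝ)))
      (fun K => (by fun_prop : Measurable _).aemeasurable) (ae_of_all _ fun ω K K' hKK' => ?_)
      (ae_of_all _ fun ω => ?_)) (Eventually.of_forall hbd)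
    · exact ENNReal.ofReal_le_ofReal (min_le_min le_rfl (by exact_mod_cast hKK'))
    · refine tendsto_const_nhds.congr' ?_
      filter_upwards [eventually_ge_atTop ⌈G ω ^ 2⌉₊] with K hK
      rw [min_eq_left (Nat.ceil_le.1 hK), Real.enorm_eq_ofReal_abs,
        ← ENNReal.ofReal_pow (abs_nonneg _), sq_abs]
  refine ⟨hsq, ?_⟩
  -- Truncation costs at most `M / K`, uniformly in `n`: once under `P n` and once under `Q`.
  have hK : ∀ K : ℝ, 0 < K → ∫ ω, G ω ∂Q ≤ c + M.toReal / K + M.toReal / K := fun K hK => by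
    have h1 := (abs_le.1 (abs_integral_sub_truncAt_le hG hM hsq hK)).2
    have h2 : ∫ ω, truncAt G K ω ∂Q ≤ c + M.toReal / K := by
      refine le_of_tendsto (hconv _ (measurable_truncAt hG K) ⟨K, abs_truncAt_le G hK.le⟩)
        (Eventually.of_forall fun n => ?_)
      have h3 := (abs_le.1 (abs_integral_sub_truncAt_le hG hM (h n).1 hK)).1
      linarith [(h n).2]
    linarith
  have hlim : Tendsto (fun K : ℝ => c + M.toReal / K + M.toReal / K) atTop (𝓝 (c + 0 + 0)) :=
    (tendsto_const_nhds.add (tendsto_const_nhds.div_atTop tendsto_id)).add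
      (tendsto_const_nhds.div_atTop tendsto_id)
  rw [add_zero, add_zero] at hlim
  exact ge_of_tendsto hlim ((eventually_gt_atTop 0).mono hK)

end SchroedingerBridge

/-! ### The entropic projection -/

namespace SchroedingerBridge

open scoped Topology

variable {Ω : Type*} [mΩ : MeasurableSpace Ω]

/-- A sequence of measures whose densities converge in `L¹` converges against bounded functions. -/
lemma tendsto_integral_of_tendsto_density {P₀ : Measure Ω} [IsProbabilityMeasure P₀]
    {P : ℕ → Measure Ω} [∀ n, IsProbabilityMeasure (P n)] (hP : ∀ n, P n ≪ P₀) {p : Ω → ℝ}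
    (hp : Integrable p P₀)
    (hlim : Tendsto (fun n => eLpNorm ((fun ω => ((P n).rnDeriv P₀ ω).toReal) - p) 1 P₀)
      atTop (𝓝 0))
    {f : Ω → ℝ} (hf : Measurable f) {C : ℝ} (hC : ∀ ω, |f ω| ≤ C) :
    Tendsto (fun n => ∫ ω, f ω ∂P n) atTop (𝓝 (∫ ω, p ω * f ω ∂P₀)) := by
  have hbdd : ∀ {g : Ω → ℝ}, Integrable g P₀ → Integrable (fun ω => g ω * f ω) P₀ := fun hg =>
    hg.mul_bdd (c := C) hf.aestronglyMeasurable (ae_of_all _ hC)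
  have hn : ∀ n, ∫ ω, f ω ∂P n = ∫ ω, ((P n).rnDeriv P₀ ω).toReal * f ω ∂P₀ := fun n => by
    rw [← integral_rnDeriv_smul (hP n)]; rfl
  simp_rw [hn]
  refine tendsto_integral_of_L1 _ (hbdd hp).aestronglyMeasurable
    (Eventually.of_forall fun n => hbdd Measure.integrable_toReal_rnDeriv) ?_
  have h0 : Tendsto (fun n => ENNReal.ofReal C *
      eLpNorm ((fun ω => ((P n).rnDeriv P₀ ω).toReal) - p) 1 P₀) atTop (𝓝 0) := by
    simpa using ENNReal.Tendsto.const_mul hlim (Or.inr ENNReal.ofReal_ne_top)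
  refine tendsto_of_tendsto_of_tendsto_of_le_of_le tendsto_const_nhds h0 (fun _ => zero_le)
    fun n => ?_
  dsimp only
  rw [eLpNorm_one_eq_lintegral_enorm, ← lintegral_const_mul' _ _ ENNReal.ofReal_ne_top]
  refine lintegral_mono fun ω => ?_
  rw [← sub_mul, enorm_mul, mul_comm, Pi.sub_apply]
  gcongr
  rw [Real.enorm_eq_ofReal_abs]
  exact ENNReal.ofReal_le_ofReal (hC ω)

/-- Lower semicontinuity of the relative entropy under `L¹`-convergence of the densities. -/
lemma klDiv_le_of_tendsto_density {P₀ : Measure Ω} [IsProbabilityMeasure P₀]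
    {P : ℕ → Measure Ω} [∀ n, IsProbabilityMeasure (P n)] (hP : ∀ n, P n ≪ P₀) {Q : Measure Ω}
    [IsProbabilityMeasure Q] (hQ : Q ≪ P₀)
    (hlim : Tendsto (fun n => eLpNorm ((fun ω => ((P n).rnDeriv P₀ ω).toReal) -
      fun ω => (Q.rnDeriv P₀ ω).toReal) 1 P₀) atTop (𝓝 0))
    {D : ℝ≥0∞} (hD : Tendsto (fun n => klDiv (P n) P₀) atTop (𝓝 D)) :
    klDiv Q P₀ ≤ D := by
  obtain ⟨ns, hns, hae⟩ := (tendstoInMeasure_of_tendsto_eLpNorm one_ne_zero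
    (fun n => Measure.integrable_toReal_rnDeriv.aestronglyMeasurable)
    (Measure.integrable_toReal_rnDeriv.aestronglyMeasurable) hlim).exists_seq_tendsto_ae
  -- As `klFun` is nonnegative, Fatou's lemma applies along an almost everywhere convergent
  -- subsequence.
  rw [klDiv_eq_lintegral_klFun_of_ac hQ]
  calc ∫⁻ ω, ENNReal.ofReal (klFun (Q.rnDeriv P₀ ω).toReal) ∂P₀
      ≤ ∫⁻ ω, liminf (fun i => ENNReal.ofReal (klFun ((P (ns i)).rnDeriv P₀ ω).toReal)) atTop
          ∂P₀ := by
        refine lintegral_mono_ae ?_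
        filter_upwards [hae] with ω hω
        exact (ENNReal.tendsto_ofReal ((continuous_klFun.tendsto _).comp hω)).liminf_eq.ge
    _ ≤ liminf (fun i => ∫⁻ ω, ENNReal.ofReal (klFun ((P (ns i)).rnDeriv P₀ ω).toReal) ∂P₀) atTop :=
        lintegral_liminf_le fun i => by fun_prop
    _ = D := by
        simp_rw [← klDiv_eq_lintegral_klFun_of_ac (hP _)]
        exact (hD.comp hns.tendsto_atTop).liminf_eq

/-- `P` satisfies every moment constraint `∫ |G|² ≤ M`, `∫ G ≤ c` that holds on all of `𝓜`. -/
def SatisfiesMoments (𝓜 : Set (Measure Ω)) (P : Measure Ω) : Prop :=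
  ∀ (G : Ω → ℝ) (M : ℝ≥0∞) (c : ℝ), Measurable G → M ≠ ∞ →
    (∀ P' ∈ 𝓜, ∫⁻ ω, ‖G ω‖ₑ ^ 2 ∂P' ≤ M ∧ ∫ ω, G ω ∂P' ≤ c) →
    ∫⁻ ω, ‖G ω‖ₑ ^ 2 ∂P ≤ M ∧ ∫ ω, G ω ∂P ≤ c

lemma isProbabilityMeasure_midpoint (P Q : Measure Ω) [IsProbabilityMeasure P]
    [IsProbabilityMeasure Q] : IsProbabilityMeasure ((2⁻¹ : ℝ≥0) • (P + Q)) := by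
  constructor
  rw [Measure.smul_apply, Measure.add_apply, measure_univ, measure_univ, one_add_one_eq_two,
    ENNReal.smul_def, smul_eq_mul, ENNReal.coe_inv two_ne_zero]
  exact ENNReal.inv_mul_cancel two_ne_zero ENNReal.ofNat_ne_top

lemma SatisfiesMoments.midpoint {𝓜 : Set (Measure Ω)} {P Q : Measure Ω} [IsProbabilityMeasure P]
    [IsProbabilityMeasure Q] (hP : SatisfiesMoments 𝓜 P) (hQ : SatisfiesMoments 𝓜 Q) :
    SatisfiesMoments 𝓜 ((2⁻¹ : ℝ≥0) • (P + Q)) := by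
  intro G M c hG hM h
  obtain ⟨hP1, hP2⟩ := hP G M c hG hM h
  obtain ⟨hQ1, hQ2⟩ := hQ G M c hG hM h
  have iP := (memLp_two_of_lintegral_le hG.aestronglyMeasurable hM hP1).integrable (by norm_num)
  have iQ := (memLp_two_of_lintegral_le hG.aestronglyMeasurable hM hQ1).integrable (by norm_num)
  constructor
  · rw [lintegral_smul_measure, lintegral_add_measure, ENNReal.smul_def, smul_eq_mul,
      ENNReal.coe_inv two_ne_zero]
    calc _ ≤ ((2 : ℝ≥0) : ℝ≥0∞)⁻¹ * (M + M) := by gcongr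
      _ = M := by
        rw [← two_mul, ← mul_assoc]
        rw [ENNReal.coe_ofNat, ENNReal.inv_mul_cancel two_ne_zero ENNReal.ofNat_ne_top, one_mul]
  · rw [integral_smul_nnreal_measure, integral_add_measure iP iQ, NNReal.smul_def, smul_eq_mul]
    push_cast
    linarith

/-- The set of probability measures of finite entropy with prescribed moment constraints has an
element of minimal entropy: the entropic projection. -/
theorem exists_entropic_projection (P₀ : Measure Ω) [IsProbabilityMeasure P₀]
    {𝓜 : Set (Measure Ω)} (hne : 𝓜.Nonempty) (hprob : ∀ P ∈ 𝓜, IsProbabilityMeasure P)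
    (hfin : ∀ P ∈ 𝓜, klDiv P P₀ ≠ ∞) :
    ∃ Q : Measure Ω, IsProbabilityMeasure Q ∧ Q ≪ P₀ ∧ (∀ P ∈ 𝓜, klDiv Q P₀ ≤ klDiv P P₀) ∧
      SatisfiesMoments 𝓜 Q := by
  -- The minimisation runs over `S` because, unlike an arbitrary `𝓜`, it contains midpoints, and the
  -- limit inherits its moment conditions.
  set S : Set (Measure Ω) := {P | IsProbabilityMeasure P ∧ P ≪ P₀ ∧ SatisfiesMoments 𝓜 P} with hS
  set D : ℝ≥0∞ := ⨅ P ∈ S, klDiv P P₀ with hDdef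
  have hsub : 𝓜 ⊆ S := fun P hP =>
    ⟨hprob P hP, (klDiv_ne_top_iff.1 (hfin P hP)).1, fun G M c _ _ h => h P hP⟩
  have hDle : ∀ P ∈ S, D ≤ klDiv P P₀ := fun P hP => iInf₂_le P hP
  have hDtop : D ≠ ∞ := by
    obtain ⟨P, hP⟩ := hne
    exact ((hDle P (hsub hP)).trans_lt (hfin P hP).lt_top).ne
  have hex : ∀ n : ℕ, ∃ P ∈ S, klDiv P P₀ < D + ((2⁻¹ : ℝ≥0) ^ n : ℝ≥0) ^ 2 := fun n => by
    have : D < D + ((2⁻¹ : ℝ≥0) ^ n : ℝ≥0) ^ 2 := ENNReal.lt_add_right hDtop (by simp)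
    rw [hDdef, iInf_lt_iff] at this
    obtain ⟨P, hP⟩ := this
    obtain ⟨hPS, hP⟩ := iInf_lt_iff.1 hP
    exact ⟨P, hPS, hP⟩
  choose P hPS hPD using hex
  have hPprob : ∀ n, IsProbabilityMeasure (P n) := fun n => (hPS n).1
  have hPac : ∀ n, P n ≪ P₀ := fun n => (hPS n).2.1
  have hhalf : (2⁻¹ : ℝ≥0) < 1 := by
    rw [← NNReal.coe_lt_coe]
    norm_num
  have hanti : ∀ {N n : ℕ}, N ≤ n → (2⁻¹ : ℝ≥0) ^ n ≤ (2⁻¹ : ℝ≥0) ^ N := fun h =>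
    pow_le_pow_of_le_one zero_le hhalf.le h
  have hcauchy : ∀ N n m : ℕ, N ≤ n → N ≤ m →
      eLpNorm ((fun ω => ((P n).rnDeriv P₀ ω).toReal) - fun ω => ((P m).rnDeriv P₀ ω).toReal) 1 P₀
        < 5 * ((2⁻¹ : ℝ≥0) ^ N : ℝ≥0) := by
    intro N n m hn hm
    set δ : ℝ≥0 := (2⁻¹ : ℝ≥0) ^ N with hδ
    have hδ0 : (δ : ℝ≥0∞) ≠ 0 := by simp [hδ]
    have h1 := two_mul_klDiv_midpoint_add_le (hPac n) (hPac m) δ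
    have hmid : (2⁻¹ : ℝ≥0) • (P n + P m) ∈ S :=
      ⟨isProbabilityMeasure_midpoint _ _, ((hPac n).add_left (hPac m)).smul_left _,
        (hPS n).2.2.midpoint (hPS m).2.2⟩
    set E := eLpNorm ((fun ω => ((P n).rnDeriv P₀ ω).toReal) -
      fun ω => ((P m).rnDeriv P₀ ω).toReal) 1 P₀
    -- Two entropies within `δ²` of `D` and the remainder `2δ²` leave `δ E ≤ 4δ²`. The constant `5`
    -- in the claim makes the bound strict.
    have h2 : 2 * D + δ * E ≤ 2 * D + δ * (4 * δ) := calc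
      2 * D + δ * E ≤ klDiv (P n) P₀ + klDiv (P m) P₀ + 2 * δ ^ 2 :=
        le_trans (by gcongr; exact hDle _ hmid) h1
      _ ≤ (D + δ ^ 2) + (D + δ ^ 2) + 2 * δ ^ 2 := by
        gcongr
        · exact (hPD n).le.trans (by gcongr; exact hanti hn)
        · exact (hPD m).le.trans (by gcongr; exact hanti hm)
      _ = 2 * D + δ * (4 * δ) := by ring
    have h3 := (ENNReal.mul_le_mul_iff_right hδ0 ENNReal.coe_ne_top).1
      ((ENNReal.add_le_add_iff_left (ENNReal.mul_ne_top ENNReal.ofNat_ne_top hDtop)).1 h2)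
    refine h3.trans_lt ?_
    rw [ENNReal.mul_lt_mul_iff_left hδ0 ENNReal.coe_ne_top]
    norm_num
  have hsum : ∑' N : ℕ, (5 : ℝ≥0∞) * ((2⁻¹ : ℝ≥0) ^ N : ℝ≥0) ≠ ∞ := by
    rw [ENNReal.tsum_mul_left]
    refine ENNReal.mul_ne_top ENNReal.ofNat_ne_top ?_
    rw [ENNReal.tsum_coe_ne_top_iff_summable]
    exact NNReal.summable_geometric hhalf
  obtain ⟨p, hp, hlim⟩ := Lp.cauchy_complete_eLpNorm le_rfl
    (fun n => memLp_one_iff_integrable.2 Measure.integrable_toReal_rnDeriv) hsum hcauchy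
  have hpi : Integrable p P₀ := memLp_one_iff_integrable.1 hp
  have hp0 : 0 ≤ᵐ[P₀] p := by
    obtain ⟨ns, hns, hae⟩ := (tendstoInMeasure_of_tendsto_eLpNorm one_ne_zero
      (fun n => Measure.integrable_toReal_rnDeriv.aestronglyMeasurable)
      hp.1 hlim).exists_seq_tendsto_ae
    filter_upwards [hae] with ω hω
    exact ge_of_tendsto hω (Eventually.of_forall fun _ => ENNReal.toReal_nonneg)
  have hconv : ∀ f : Ω → ℝ, Measurable f → (∃ C, ∀ ω, |f ω| ≤ C) →
      Tendsto (fun n => ∫ ω, f ω ∂P n) atTop (𝓝 (∫ ω, p ω * f ω ∂P₀)) := fun f hf ⟨C, hC⟩ =>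
    tendsto_integral_of_tendsto_density hPac hpi hlim hf hC
  have hp1 : ∫ ω, p ω ∂P₀ = 1 := by
    have h := hconv (fun _ => 1) measurable_const ⟨1, by simp⟩
    simp only [integral_const, probReal_univ, smul_eq_mul, mul_one] at h
    exact tendsto_nhds_unique h tendsto_const_nhds
  set Q := P₀.withDensity fun ω => ENNReal.ofReal (p ω) with hQ
  have hQprob : IsProbabilityMeasure Q := by
    constructor
    rw [hQ, withDensity_apply _ .univ, setLIntegral_univ,
      ← ofReal_integral_eq_lintegral_ofReal hpi hp0, hp1, ENNReal.ofReal_one]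
  have hQac : Q ≪ P₀ := withDensity_absolutelyContinuous _ _
  have hQp : (fun ω => (Q.rnDeriv P₀ ω).toReal) =ᵐ[P₀] p := by
    filter_upwards [Measure.rnDeriv_withDensity₀ P₀ hpi.aemeasurable.ennreal_ofReal, hp0]
      with ω h1 h2
    rw [h1, ENNReal.toReal_ofReal h2]
  have hconv' : ∀ f : Ω → ℝ, Measurable f → (∃ C, ∀ ω, |f ω| ≤ C) →
      Tendsto (fun n => ∫ ω, f ω ∂P n) atTop (𝓝 (∫ ω, f ω ∂Q)) := fun f hf hC => by
    have h : ∫ ω, f ω ∂Q = ∫ ω, p ω * f ω ∂P₀ := by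
      rw [← integral_rnDeriv_smul hQac]
      exact integral_congr_ae (hQp.mono fun ω hω => by
        simp only [smul_eq_mul] at hω ⊢
        rw [hω])
    rw [h]
    exact hconv f hf hC
  have hDlim : Tendsto (fun n => klDiv (P n) P₀) atTop (𝓝 D) := by
    refine tendsto_of_tendsto_of_tendsto_of_le_of_le (g := fun _ => D)
      (h := fun n => D + (((2⁻¹ : ℝ≥0) ^ n : ℝ≥0) : ℝ≥0∞) ^ 2) tendsto_const_nhds ?_
      (fun n => hDle _ (hPS n)) (fun n => (hPD n).le)
    have h0 : Tendsto (fun n : ℕ => (((2⁻¹ : ℝ≥0) ^ n : ℝ≥0) : ℝ≥0∞)) atTop (𝓝 0) := by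
      rw [← ENNReal.coe_zero]
      exact ENNReal.tendsto_coe.2 (NNReal.tendsto_pow_atTop_nhds_zero_of_lt_one hhalf)
    simpa using (tendsto_const_nhds (x := D)).add (ENNReal.Tendsto.pow (n := 2) h0)
  refine ⟨Q, hQprob, hQac, fun P' hP' => ?_, fun G M c hG hM h => ?_⟩
  · refine (klDiv_le_of_tendsto_density hPac hQac ?_ hDlim).trans (hDle P' (hsub hP'))
    refine hlim.congr fun n => eLpNorm_congr_ae ?_
    filter_upwards [hQp] with ω hω
    simp only [Pi.sub_apply, hω]
  · exact moment_constraint_of_tendsto hconv' hG hM fun n => (hPS n).2.2 G M c hG hM h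

end SchroedingerBridge

/-! ### Testing the convex order on finite maxima of affine functions -/

namespace SchroedingerBridge

open scoped Topology

/-- The maximum of the first `n + 1` of a sequence of affine functions. -/
noncomputable def affineMax (a b : ℕ → ℝ) (n : ℕ) (x : ℝ) : ℝ :=
  partialSups (fun i => a i + b i * x) n

lemma le_affineMax (a b : ℕ → ℝ) {i n : ℕ} (hi : i ≤ n) (x : ℝ) :
    a i + b i * x ≤ affineMax a b n x :=
  le_partialSups_of_le (fun i => a i + b i * x) hi

lemma affineMax_le {a b : ℕ → ℝ} {n : ℕ} {x r : ℝ} (h : ∀ i ≤ n, a i + b i * x ≤ r) :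
    affineMax a b n x ≤ r :=
  partialSups_le _ _ _ h

lemma affineMax_mono (a b : ℕ → ℝ) (x : ℝ) : Monotone fun n => affineMax a b n x :=
  (partialSups fun i => a i + b i * x).monotone

lemma exists_eq_affineMax (a b : ℕ → ℝ) (n : ℕ) (x : ℝ) :
    ∃ i, i ≤ n ∧ a i + b i * x = affineMax a b n x := by
  obtain ⟨i, hi, h⟩ := Finset.exists_mem_eq_sup' Finset.nonempty_range_add_one
    (f := fun i => a i + b i * x) (s := Finset.range (n + 1))
  refine ⟨i, by simpa [Nat.lt_succ_iff] using hi, ?_⟩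
  rw [affineMax, partialSups_eq_sup'_range, h]

lemma measurable_affineMax (a b : ℕ → ℝ) (n : ℕ) : Measurable (affineMax a b n) := by
  unfold affineMax
  induction n with
  | zero => simp only [partialSups_zero]; fun_prop
  | succ n ih => simp only [partialSups_add_one]; exact ih.max (by fun_prop)

lemma convexOn_affineMax (a b : ℕ → ℝ) (n : ℕ) {s : Set ℝ} (hs : Convex ℝ s) :
    ConvexOn ℝ s (affineMax a b n) := by
  refine ⟨hs, fun x _ y _ u v hu hv huv => affineMax_le fun i hi => ?_⟩
  have h1 := mul_le_mul_of_nonneg_left (le_affineMax a b hi x) hu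
  have h2 := mul_le_mul_of_nonneg_left (le_affineMax a b hi y) hv
  simp only [smul_eq_mul]
  have h3 : a i = u * a i + v * a i := by rw [← add_mul, huv, one_mul]
  linarith

lemma abs_affineMax_le (a b : ℕ → ℝ) (n : ℕ) (x : ℝ) :
    |affineMax a b n x| ≤
      ∑ i ∈ Finset.range (n + 1), |a i| + (∑ i ∈ Finset.range (n + 1), |b i|) * |x| := by
  obtain ⟨i, hi, h⟩ := exists_eq_affineMax a b n x
  have hmem : i ∈ Finset.range (n + 1) := by simpa [Nat.lt_succ_iff] using hi
  rw [← h]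
  refine (abs_add_le _ _).trans (add_le_add ?_ ?_)
  · exact Finset.single_le_sum (f := fun i => |a i|) (fun _ _ => abs_nonneg _) hmem
  · rw [abs_mul]
    gcongr
    exact Finset.single_le_sum (f := fun i => |b i|) (fun _ _ => abs_nonneg _) hmem

lemma affineMax_nonneg {a b : ℕ → ℝ} (ha : a 0 = 0) (hb : b 0 = 0) (n : ℕ) (x : ℝ) :
    0 ≤ affineMax a b n x := by
  simpa [ha, hb] using le_affineMax a b (Nat.zero_le n) x

lemma add_rightDeriv_mul_le {g : ℝ → ℝ} {s : Set ℝ} (hg : ConvexOn ℝ s g) {q y : ℝ}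
    (hq : q ∈ interior s) (hy : y ∈ s) : g q + derivWithin g (Ioi q) q * (y - q) ≤ g y := by
  rcases lt_trichotomy q y with h | rfl | h
  · have h1 := hg.rightDeriv_le_slope_of_mem_interior hq hy h
    rw [slope_def_field, le_div_iff₀ (sub_pos.2 h)] at h1
    linarith
  · simp
  · have h1 := (hg.slope_le_leftDeriv_of_mem_interior hy hq h).trans
      (hg.leftDeriv_le_rightDeriv_of_mem_interior hq)
    rw [slope_def_field, div_le_iff₀ (sub_pos.2 h)] at h1
    linarith

/-- A nonnegative convex function on `[0, ∞)` is, on `(0, ∞)`, the supremum of a sequence of affine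
minorants that starts with `0`. -/
lemma exists_affine_sequence {g : ℝ → ℝ} (hg : ConvexOn ℝ (Ici 0) g)
    (hg0 : ∀ x ∈ Ici (0 : ℝ), 0 ≤ g x) :
    ∃ a b : ℕ → ℝ, a 0 = 0 ∧ b 0 = 0 ∧ (∀ i, ∀ y ∈ Ici (0 : ℝ), a i + b i * y ≤ g y) ∧
      ∀ x, 0 < x → ∀ r < g x, ∃ i, r < a i + b i * x := by
  have : Nonempty (Ioi (0 : ℝ)) := ⟨⟨1, by simp⟩⟩
  let q : ℕ → Ioi (0 : ℝ) := TopologicalSpace.denseSeq _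
  let d : ℝ → ℝ := fun x => derivWithin g (Ioi x) x
  have hint : ∀ {z : ℝ}, 0 < z → z ∈ interior (Ici (0 : ℝ)) := fun hz => by rwa [interior_Ici]
  refine ⟨fun i => Nat.casesOn i 0 fun j => g (q j) - d (q j) * q j,
    fun i => Nat.casesOn i 0 fun j => d (q j), rfl, rfl, fun i y hy => ?_, fun x hx r hr => ?_⟩
  · cases i with
    | zero => simpa using hg0 y hy
    | succ j =>
      have := add_rightDeriv_mul_le hg (hint (q j).2) hy
      simp only [d]
      linarith
  · have hcont : ContinuousAt g x :=
      (hg.continuousOn_interior.continuousAt (isOpen_interior.mem_nhds (hint hx)))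
    -- A tangent at a dense point `q` just left of `x` has slope at least `d (x / 2)`, by
    -- monotonicity of the right derivative. Its value at `x` is therefore at least the expression
    -- here at `z = q`, which is close to `g x`.
    have hlim : Tendsto (fun z => g z + d (x / 2) * (x - z)) (𝓝 x) (𝓝 (g x + d (x / 2) * (x - x))) :=
      hcont.tendsto.add (tendsto_const_nhds.mul (tendsto_const_nhds.sub tendsto_id))
    rw [sub_self, mul_zero, add_zero] at hlim
    have hev := hlim.eventually (lt_mem_nhds hr)
    obtain ⟨l, hl, hlx⟩ := (mem_nhdsLE_iff_exists_Ioc_subset).1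
      (mem_nhdsWithin_of_mem_nhds hev : _ ∈ 𝓝[≤] x)
    have hl' : l < x := hl
    have hne : max l (x / 2) < x := max_lt hl' (by linarith)
    have hopen : IsOpen {z : Ioi (0 : ℝ) | (z : ℝ) ∈ Ioo (max l (x / 2)) x} :=
      isOpen_Ioo.preimage continuous_subtype_val
    have hnonempty : {z : Ioi (0 : ℝ) | (z : ℝ) ∈ Ioo (max l (x / 2)) x}.Nonempty := by
      obtain ⟨z, hz⟩ := exists_between hne
      exact ⟨⟨z, (by linarith [le_max_right l (x / 2), hz.1] : 0 < z)⟩, hz⟩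
    obtain ⟨j, hj⟩ := (TopologicalSpace.denseRange_denseSeq (Ioi (0 : ℝ))).exists_mem_open
      hopen hnonempty
    refine ⟨j + 1, ?_⟩
    change r < (g (q j) - d (q j) * q j) + d (q j) * x
    have hj1 : max l (x / 2) < (q j : ℝ) := hj.1
    have hj2 : (q j : ℝ) < x := hj.2
    have h1 : r < g (q j) + d (x / 2) * (x - q j) :=
      hlx ⟨(le_max_left _ _).trans_lt hj1, hj2.le⟩
    have h2 : d (x / 2) ≤ d (q j) := by
      exact hg.monotoneOn_rightDeriv (hint (half_pos hx)) (hint (q j).2)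
        ((le_max_right _ _).trans hj1.le)
    nlinarith [mul_le_mul_of_nonneg_right h2 (sub_nonneg.2 hj2.le)]

/-- On `[0, ∞)` the tests `max 0 (1 - k x)` decrease to the indicator of `{0}`. This handles convex
functions that jump at the boundary point. -/
lemma measure_singleton_zero_le_of_affineMax {μ ν : Measure ℝ} [IsFiniteMeasure ν]
    (h : ∀ (a b : ℕ → ℝ) (n : ℕ), a 0 = 0 → b 0 = 0 →
      ∫⁻ x in Ici 0, ENNReal.ofReal (affineMax a b n x) ∂μ ≤
        ∫⁻ x in Ici 0, ENNReal.ofReal (affineMax a b n x) ∂ν) :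
    μ {0} ≤ ν {0} := by
  have hsingle : ∀ ρ : Measure ℝ, ∫⁻ x in Ici 0, indicator {0} 1 x ∂ρ = ρ {0} := fun ρ => by
    rw [lintegral_indicator_one (measurableSet_singleton 0),
      Measure.restrict_apply (measurableSet_singleton 0),
      inter_eq_left.2 (by simp : {(0 : ℝ)} ⊆ Ici 0)]
  have hmax : ∀ (k : ℕ) (x : ℝ),
      affineMax (fun i => if i = 0 then 0 else 1) (fun i => if i = 0 then 0 else -(k : ℝ)) 1 x =
        max 0 (1 - k * x) := fun k x => by
    rw [affineMax, show (1 : ℕ) = 0 + 1 from rfl, partialSups_add_one, partialSups_zero]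
    simp [sub_eq_add_neg]
  have hle : ∀ k : ℕ, μ {0} ≤ ∫⁻ x in Ici 0, ENNReal.ofReal (max 0 (1 - k * x)) ∂ν := fun k => by
    have hk := h (fun i => if i = 0 then 0 else 1) (fun i => if i = 0 then 0 else -(k : ℝ)) 1
      (by simp) (by simp)
    simp_rw [hmax] at hk
    refine le_trans ?_ hk
    rw [← hsingle μ]
    refine lintegral_mono fun x => ?_
    rcases eq_or_ne x 0 with rfl | hx
    · simp
    · simp [hx]
  have hlim : Tendsto (fun k : ℕ => ∫⁻ x in Ici 0, ENNReal.ofReal (max 0 (1 - k * x)) ∂ν) atTop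
      (𝓝 (∫⁻ x in Ici 0, indicator {0} 1 x ∂ν)) := by
    refine tendsto_lintegral_of_dominated_convergence (fun _ => 1) (fun k => by fun_prop)
      (fun k => (ae_restrict_mem measurableSet_Ici).mono fun x hx => ?_) (by simp)
      ((ae_restrict_mem measurableSet_Ici).mono fun x hx => ?_)
    · rw [← ENNReal.ofReal_one]
      refine ENNReal.ofReal_le_ofReal (max_le zero_le_one ?_)
      have : 0 ≤ (k : ℝ) * x := mul_nonneg k.cast_nonneg hx
      linarith
    · rcases (mem_Ici.1 hx).eq_or_lt with rfl | hx
      · simp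
      · refine tendsto_const_nhds.congr' ?_
        filter_upwards [eventually_ge_atTop ⌈x⁻¹⌉₊] with k hk
        have h1 : 1 ≤ (k : ℝ) * x := by
          have := mul_le_mul_of_nonneg_right (Nat.ceil_le.1 hk) hx.le
          rwa [inv_mul_cancel₀ hx.ne'] at this
        rw [indicator_of_notMem (by simpa using hx.ne'), max_eq_left (by linarith),
          ENNReal.ofReal_zero]
  rw [hsingle] at hlim
  exact ge_of_tendsto hlim (Eventually.of_forall hle)

/-- The order `≤_{c,l}` only has to be tested on finite maxima of affine functions and `0`. -/
lemma convexOrderLB_of_affineMax {μ ν : Measure ℝ} [IsFiniteMeasure ν]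
    (hμ : μ (Iio 0) = 0) (hν : ν (Iio 0) = 0)
    (h : ∀ (a b : ℕ → ℝ) (n : ℕ), a 0 = 0 → b 0 = 0 →
      ∫⁻ x in Ici 0, ENNReal.ofReal (affineMax a b n x) ∂μ ≤
        ∫⁻ x in Ici 0, ENNReal.ofReal (affineMax a b n x) ∂ν) :
    ConvexOrderLB μ ν := by
  refine ⟨hμ, hν, fun g c hg hc => ?_⟩
  have hg' : ConvexOn ℝ (Ici 0) fun x => g x - c := by
    exact hg.add_const (-c)
  obtain ⟨a, b, ha, hb, hle, hsup⟩ := exists_affine_sequence hg' fun x hx => by linarith [hc x hx]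
  set s : ℝ → ℝ≥0∞ := fun x => ⨆ n, ENNReal.ofReal (affineMax a b n x) with hs
  -- A convex function on `[0, ∞)` may jump up at `0`, where affine minorants need not reach it. On
  -- `[0, ∞)`, `g - c` is `s` plus the jump `e` at the origin.
  set e : ℝ≥0∞ := ENNReal.ofReal (g 0 - c) - s 0 with he
  have hsle : ∀ x ∈ Ici (0 : ℝ), s x ≤ ENNReal.ofReal (g x - c) := fun x hx =>
    iSup_le fun n => ENNReal.ofReal_le_ofReal (affineMax_le fun i _ => hle i x hx)
  have hspos : ∀ x, 0 < x → s x = ENNReal.ofReal (g x - c) := fun x hx => by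
    refine le_antisymm (hsle x hx.le) (le_of_forall_lt fun r hr => ?_)
    have hrtop : r ≠ ∞ := hr.ne_top
    obtain ⟨i, hi⟩ := hsup x hx r.toReal ((ENNReal.lt_ofReal_iff_toReal_lt hrtop).1 hr)
    refine lt_of_lt_of_le ?_ (le_iSup (fun n => ENNReal.ofReal (affineMax a b n x)) i)
    exact (ENNReal.lt_ofReal_iff_toReal_lt hrtop).2 (hi.trans_le (le_affineMax a b le_rfl x))
  have hdecomp : ∀ ρ : Measure ℝ, ∫⁻ x in Ici 0, ENNReal.ofReal (g x - c) ∂ρ =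
      (⨆ n, ∫⁻ x in Ici 0, ENNReal.ofReal (affineMax a b n x) ∂ρ) + e * ρ {0} := fun ρ => by
    rw [← lintegral_iSup (fun n => (measurable_affineMax a b n).ennreal_ofReal)
      (fun n m hnm x => ENNReal.ofReal_le_ofReal (affineMax_mono a b x hnm))]
    have h0 : e * ρ {0} = ∫⁻ x in Ici 0, indicator {0} (fun _ => e) x ∂ρ := by
      rw [lintegral_indicator_const (measurableSet_singleton 0),
        Measure.restrict_apply (measurableSet_singleton 0),
        inter_eq_left.2 (by simp : {(0 : ℝ)} ⊆ Ici 0)]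
    rw [h0, ← lintegral_add_right _ (measurable_const.indicator (measurableSet_singleton 0))]
    refine setLIntegral_congr_fun measurableSet_Ici fun x hx => ?_
    change _ = s x + _
    rcases (mem_Ici.1 hx).eq_or_lt with rfl | hx
    · rw [indicator_of_mem (mem_singleton _), he, add_tsub_cancel_of_le (hsle 0 (by simp))]
    · rw [indicator_of_notMem (by simpa using hx.ne'), add_zero, hspos x hx]
  rw [hdecomp, hdecomp]
  gcongr ?_ + e * ?_
  · exact iSup_mono fun n => h a b n ha hb
  · exact measure_singleton_zero_le_of_affineMax h

end SchroedingerBridge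

/-! ### Laws and the martingale property as moment constraints -/

namespace SchroedingerBridge

open scoped Topology

variable {Ω : Type*} [mΩ : MeasurableSpace Ω]

lemma enorm_sq_le_of_abs_le {g a b : ℝ} (h : |g| ≤ |a| + |b|) :
    ‖g‖ₑ ^ 2 ≤ 2 * (‖a‖ₑ ^ 2 + ‖b‖ₑ ^ 2) := by
  have h2 : (2 : ℝ≥0∞) = ENNReal.ofReal 2 := by simp
  simp only [Real.enorm_eq_ofReal_abs, h2, ← ENNReal.ofReal_pow (abs_nonneg _), sq_abs]
  rw [← ENNReal.ofReal_add (sq_nonneg _) (sq_nonneg _), ← ENNReal.ofReal_mul (by norm_num)]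
  refine ENNReal.ofReal_le_ofReal ?_
  have h3 : |g| ^ 2 ≤ (|a| + |b|) ^ 2 := by gcongr
  rw [← sq_abs g, ← sq_abs a, ← sq_abs b]
  nlinarith [sq_nonneg (|a| - |b|)]

lemma lintegral_enorm_sq_le_of_abs_le {P : Measure Ω} {G A B : Ω → ℝ} (hA : Measurable A)
    (h : ∀ ω, |G ω| ≤ |A ω| + |B ω|) {M N : ℝ≥0∞}
    (hM : ∫⁻ ω, ‖A ω‖ₑ ^ 2 ∂P ≤ M) (hN : ∫⁻ ω, ‖B ω‖ₑ ^ 2 ∂P ≤ N) :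
    ∫⁻ ω, ‖G ω‖ₑ ^ 2 ∂P ≤ 2 * (M + N) := by
  refine (lintegral_mono fun ω => enorm_sq_le_of_abs_le (h ω)).trans ?_
  rw [lintegral_const_mul' _ _ (by simp), lintegral_add_left (by fun_prop)]
  gcongr

lemma lintegral_enorm_sq_condExp_le (P : Measure Ω) (m : MeasurableSpace Ω) (f : Ω → ℝ) :
    ∫⁻ ω, ‖(P[f | m]) ω‖ₑ ^ 2 ∂P ≤ ∫⁻ ω, ‖f ω‖ₑ ^ 2 ∂P := by
  have h : ∀ g : Ω → ℝ, ∫⁻ ω, ‖g ω‖ₑ ^ 2 ∂P = eLpNorm g 2 P ^ (2 : ℝ) := fun g => by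
    have := eLpNorm_nnreal_pow_eq_lintegral (f := g) (μ := P) (p := 2) two_ne_zero
    simpa using this.symm
  rw [h, h]
  gcongr
  exact eLpNorm_condExp_le_eLpNorm f (by norm_num)

/-- A second-moment bound alone is an admissible constraint: truncating at level `1` gives the mean
bound `1 + M` for free. -/
lemma SatisfiesMoments.lintegral_le {𝓜 : Set (Measure Ω)} {Q : Measure Ω}
    (hQ : SatisfiesMoments 𝓜 Q) (hprob : ∀ P ∈ 𝓜, IsProbabilityMeasure P) {G : Ω → ℝ}
    (hG : Measurable G) {M : ℝ≥0∞} (hM : M ≠ ∞) (h : ∀ P ∈ 𝓜, ∫⁻ ω, ‖G ω‖ₑ ^ 2 ∂P ≤ M) :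
    ∫⁻ ω, ‖G ω‖ₑ ^ 2 ∂Q ≤ M := by
  refine (hQ G M (1 + M.toReal) hG hM fun P hP => ⟨h P hP, ?_⟩).1
  have := hprob P hP
  have h1 := (abs_le.1 (abs_integral_sub_truncAt_le hG hM (h P hP) one_pos)).2
  have h2 := norm_integral_le_of_norm_le_const (μ := P) (f := truncAt G 1)
    (ae_of_all _ fun ω => abs_truncAt_le G zero_le_one ω)
  rw [probReal_univ, one_mul] at h2
  linarith [le_abs_self (∫ ω, truncAt G 1 ω ∂P), Real.norm_eq_abs (∫ ω, truncAt G 1 ω ∂P)]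

lemma SatisfiesMoments.integral_eq {𝓜 : Set (Measure Ω)} {Q : Measure Ω}
    (hQ : SatisfiesMoments 𝓜 Q) {G : Ω → ℝ} (hG : Measurable G) {M : ℝ≥0∞} (hM : M ≠ ∞) {c : ℝ}
    (h : ∀ P ∈ 𝓜, ∫⁻ ω, ‖G ω‖ₑ ^ 2 ∂P ≤ M ∧ ∫ ω, G ω ∂P = c) : ∫ ω, G ω ∂Q = c := by
  refine le_antisymm (hQ G M c hG hM fun P hP => ⟨(h P hP).1, (h P hP).2.le⟩).2 ?_
  have h1 := (hQ (fun ω => -G ω) M (-c) hG.neg hM fun P hP => by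
    simp only [enorm_neg, integral_neg, (h P hP).2]
    exact ⟨(h P hP).1, le_rfl⟩).2
  rw [integral_neg] at h1
  linarith

lemma SatisfiesMoments.hasLaw {𝓜 : Set (Measure Ω)} {Q : Measure Ω} [IsProbabilityMeasure Q]
    (hQ : SatisfiesMoments 𝓜 Q) (hprob : ∀ P ∈ 𝓜, IsProbabilityMeasure P) {Z : Ω → ℝ}
    (hZ : Measurable Z) {μ : Measure ℝ} [IsProbabilityMeasure μ] (h : ∀ P ∈ 𝓜, HasLaw Z μ P) :
    HasLaw Z μ Q := by
  refine ⟨hZ.aemeasurable, Measure.ext fun B hB => ?_⟩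
  have hint : ∀ P : Measure Ω, ∫ ω, (Z ⁻¹' B).indicator (fun _ => (1 : ℝ)) ω ∂P =
      P.real (Z ⁻¹' B) := fun P => integral_indicator_one (hZ hB)
  -- The probability of each event `Z ∈ B` is a bounded moment, constant on `𝓜`.
  have h1 := hQ.integral_eq (G := (Z ⁻¹' B).indicator fun _ => 1)
    (measurable_const.indicator (hZ hB)) ENNReal.one_ne_top (c := μ.real B) fun P hP => by
      have := hprob P hP
      constructor
      · calc _ ≤ ∫⁻ _, 1 ∂P := lintegral_mono fun ω => by
              by_cases hω : ω ∈ Z ⁻¹' B <;> simp [hω]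
          _ = 1 := by simp
      · rw [hint, ← (h P hP).map_eq, map_measureReal_apply hZ hB]
  rw [hint, ← map_measureReal_apply hZ hB] at h1
  have := Measure.isProbabilityMeasure_map (μ := Q) hZ.aemeasurable
  exact (measureReal_eq_measureReal_iff).1 h1

lemma SatisfiesMoments.martingale {ι : Type*} [Preorder ι] {𝓖 : Filtration ι mΩ}
    {𝓜 : Set (Measure Ω)} {Q : Measure Ω} [IsProbabilityMeasure Q]
    (hQ : SatisfiesMoments 𝓜 Q) (hprob : ∀ P ∈ 𝓜, IsProbabilityMeasure P) {Z : ι → Ω → ℝ}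
    (hadapted : StronglyAdapted 𝓖 Z) (h : ∀ P ∈ 𝓜, Martingale Z 𝓖 P) {M : ℝ≥0∞} (hM : M ≠ ∞)
    (hZM : ∀ P ∈ 𝓜, ∀ t, ∫⁻ ω, ‖Z t ω‖ₑ ^ 2 ∂P ≤ M) : Martingale Z 𝓖 Q := by
  have hmeas : ∀ t, Measurable (Z t) := fun t => ((hadapted t).mono (𝓖.le t)).measurable
  have hint : ∀ t, Integrable (Z t) Q := fun t => by
    have h2 := hQ.lintegral_le hprob (hmeas t) hM fun P hP => hZM P hP t
    exact (memLp_two_of_lintegral_le (hmeas t).aestronglyMeasurable hM h2).integrable (by norm_num)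
  refine ⟨hadapted, fun s t hst => ?_⟩
  symm
  refine ae_eq_condExp_of_forall_setIntegral_eq (𝓖.le s) (hint t) (fun A _ _ => (hint s).integrableOn)
    (fun A hA _ => ?_) (hadapted s).aestronglyMeasurable
  have hA' := 𝓖.le s A hA
  -- For `A` in the past of `s`, this moment vanishes on all of `𝓜`, hence under `Q`.
  have h1 := hQ.integral_eq (G := A.indicator (Z t - Z s))
    (((hmeas t).sub (hmeas s)).indicator hA') (M := 2 * (M + M)) (by finiteness) (c := 0)
    fun P hP => by
      have := hprob P hP
      constructor
      · refine lintegral_enorm_sq_le_of_abs_le (hmeas t) (fun ω => ?_) (hZM P hP t) (hZM P hP s)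
        by_cases hω : ω ∈ A
        · simpa [hω] using abs_sub (Z t ω) (Z s ω)
        · simp [hω]; positivity
      · rw [integral_indicator hA']
        simp only [Pi.sub_apply]
        rw [integral_sub ((h P hP).integrable t).integrableOn ((h P hP).integrable s).integrableOn,
          (h P hP).setIntegral_eq hst hA, sub_self]
  rw [integral_indicator hA'] at h1
  simp only [Pi.sub_apply] at h1
  rw [integral_sub (hint t).integrableOn (hint s).integrableOn] at h1
  linarith

end SchroedingerBridge

/-! ### Convex order of conditional expectations as a moment constraint -/

namespace SchroedingerBridge

open scoped Topology

variable {Ω : Type*} {m : MeasurableSpace Ω} [mΩ : MeasurableSpace Ω]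

lemma abs_le_sum_of_le (a : ℕ → ℝ) {i n : ℕ} (hi : i ≤ n) :
    |a i| ≤ ∑ j ∈ Finset.range (n + 1), |a j| :=
  Finset.single_le_sum (f := fun j => |a j|) (fun _ _ => abs_nonneg _)
    (Finset.mem_range.2 (Nat.lt_succ_of_le hi))

/-- A random selection, measurable with respect to the conditioning σ-algebra, from finitely many
affine functions has the same expectation at a random variable and at its conditional
expectation. -/
lemma integral_selected_affine_condExp {P : Measure Ω} [IsProbabilityMeasure P]
    (hm : m ≤ mΩ) {L : Ω → ℝ} (hL : Integrable L P) (a b : ℕ → ℝ) {n : ℕ}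
    {τ : Ω → ℕ} (hτ : Measurable[m] τ) (hτn : ∀ ω, τ ω ≤ n) :
    Integrable (fun ω => a (τ ω) + b (τ ω) * (P[L | m]) ω) P ∧
      ∫ ω, a (τ ω) + b (τ ω) * L ω ∂P = ∫ ω, a (τ ω) + b (τ ω) * (P[L | m]) ω ∂P := by
  have hsm : ∀ c : ℕ → ℝ, StronglyMeasurable[m] fun ω => c (τ ω) := fun c =>
    ((measurable_of_countable c).comp hτ).stronglyMeasurable
  have hi : ∀ (c : ℕ → ℝ) {f : Ω → ℝ}, Integrable f P → Integrable (fun ω => c (τ ω) * f ω) P :=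
    fun c f hf => hf.bdd_mul (c := ∑ j ∈ Finset.range (n + 1), |c j|)
      ((hsm c).mono hm).aestronglyMeasurable (ae_of_all _ fun ω => abs_le_sum_of_le c (hτn ω))
  have ha : Integrable (fun ω => a (τ ω)) P := by
    simpa using hi a (integrable_const (1 : ℝ))
  have hV : Integrable (P[L | m]) P := integrable_condExp
  refine ⟨ha.add (hi b hV), ?_⟩
  rw [integral_add ha (hi b hL), integral_add ha (hi b hV)]
  congr 1
  have h1 : P[(fun ω => b (τ ω)) * L | m] =ᵐ[P] (fun ω => b (τ ω)) * P[L | m] :=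
    condExp_mul_of_stronglyMeasurable_left (hsm b) (hi b hL) hL
  calc ∫ ω, b (τ ω) * L ω ∂P = ∫ ω, (P[(fun ω => b (τ ω)) * L | m]) ω ∂P :=
        (integral_condExp hm).symm
    _ = _ := integral_congr_ae h1

lemma setLIntegral_Ici_map {P : Measure Ω} {V : Ω → ℝ} (hV : Measurable V)
    (h0 : P.map V (Iio 0) = 0) {f : ℝ → ℝ≥0∞} (hf : Measurable f) :
    ∫⁻ x in Ici 0, f x ∂(P.map V) = ∫⁻ ω, f (V ω) ∂P := by
  rw [Measure.restrict_eq_self_of_ae_mem, lintegral_map hf hV]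
  rw [ae_iff]
  simpa [Iio] using h0

lemma lintegral_affineMax_ne_top {μ : Measure ℝ} [IsFiniteMeasure μ] (hμ : Integrable id μ)
    (a b : ℕ → ℝ) (n : ℕ) : ∫⁻ x in Ici 0, ENNReal.ofReal (affineMax a b n x) ∂μ ≠ ∞ := by
  have hi : Integrable (affineMax a b n) μ := by
    refine Integrable.mono' ((integrable_const (∑ i ∈ Finset.range (n + 1), |a i|)).add
      (hμ.abs.const_mul (∑ i ∈ Finset.range (n + 1), |b i|)))
      (measurable_affineMax a b n).aestronglyMeasurable (ae_of_all _ fun x => ?_)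
    exact abs_affineMax_le a b n x
  refine ((lintegral_mono fun x => ?_).trans_lt hi.restrict.2).ne
  rw [Real.enorm_eq_ofReal_abs]
  exact ENNReal.ofReal_le_ofReal (le_abs_self _)

lemma ae_nonneg_of_map_Iio {P : Measure Ω} {V : Ω → ℝ} (hV : Measurable V) :
    P.map V (Iio 0) = 0 ↔ ∀ᵐ ω ∂P, 0 ≤ V ω := by
  rw [Measure.map_apply hV measurableSet_Iio, ae_iff]
  simp only [not_le]
  rfl

/-- Any `m`-measurable selection stays below the maximum. The selection `τ` need not be related to
`P`, so one chosen for another measure can be tested here. -/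
lemma integral_selected_affine_le {P : Measure Ω} [IsProbabilityMeasure P]
    (hm : m ≤ mΩ) {L : Ω → ℝ} (hL : Integrable L P) {μ : Measure ℝ} [IsFiniteMeasure μ]
    (hμ : Integrable id μ) (h : ConvexOrderLB (P.map (P[L | m])) μ) {a b : ℕ → ℝ} (ha : a 0 = 0)
    (hb : b 0 = 0) {n : ℕ} {τ : Ω → ℕ} (hτ : Measurable[m] τ) (hτn : ∀ ω, τ ω ≤ n) :
    ∫ ω, a (τ ω) + b (τ ω) * L ω ∂P ≤
      (∫⁻ x in Ici 0, ENNReal.ofReal (affineMax a b n x) ∂μ).toReal := by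
  obtain ⟨hi, heq⟩ := integral_selected_affine_condExp hm hL a b hτ hτn
  have hV : Measurable (P[L | m]) := (stronglyMeasurable_condExp.mono hm).measurable
  have h1 := h.2.2 (affineMax a b n) 0 (convexOn_affineMax a b n (convex_Ici 0))
    fun x _ => affineMax_nonneg ha hb n x
  simp only [sub_zero] at h1
  have htop := lintegral_affineMax_ne_top hμ a b n
  rw [setLIntegral_Ici_map hV h.1 (measurable_affineMax a b n).ennreal_ofReal] at h1
  rw [heq, ← ENNReal.ofReal_le_ofReal_iff ENNReal.toReal_nonneg, ENNReal.ofReal_toReal htop]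
  refine le_trans ?_ h1
  calc _ ≤ ENNReal.ofReal (∫ ω, max (a (τ ω) + b (τ ω) * (P[L | m]) ω) 0 ∂P) :=
        ENNReal.ofReal_le_ofReal (integral_mono hi hi.pos_part fun ω => le_max_left _ _)
    _ = ∫⁻ ω, ENNReal.ofReal (max (a (τ ω) + b (τ ω) * (P[L | m]) ω) 0) ∂P :=
        ofReal_integral_eq_lintegral_ofReal hi.pos_part (ae_of_all _ fun ω => le_max_right _ _)
    _ ≤ _ := lintegral_mono fun ω => ENNReal.ofReal_le_ofReal
        (max_le (le_affineMax a b (hτn ω) _) (affineMax_nonneg ha hb n _))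

lemma SatisfiesMoments.convexOrderLB_condExp {𝓜 : Set (Measure Ω)} {Q : Measure Ω}
    [IsProbabilityMeasure Q] (hQ : SatisfiesMoments 𝓜 Q) (hprob : ∀ P ∈ 𝓜, IsProbabilityMeasure P)
    (hm : m ≤ mΩ) {L : Ω → ℝ} (hL : Measurable L) {M : ℝ≥0∞} (hM : M ≠ ∞)
    (hLM : ∀ P ∈ 𝓜, ∫⁻ ω, ‖L ω‖ₑ ^ 2 ∂P ≤ M) {μ : Measure ℝ} [IsFiniteMeasure μ]
    (hμ : Integrable id μ) (hμ0 : μ (Iio 0) = 0)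
    (h : ∀ P ∈ 𝓜, ConvexOrderLB (P.map (P[L | m])) μ) : ConvexOrderLB (Q.map (Q[L | m])) μ := by
  have hLQ : Integrable L Q := (memLp_two_of_lintegral_le hL.aestronglyMeasurable hM
    (hQ.lintegral_le hprob hL hM hLM)).integrable (by norm_num)
  have hVm : Measurable[m] (Q[L | m]) := stronglyMeasurable_condExp.measurable
  have hV : Measurable (Q[L | m]) := hVm.mono hm le_rfl
  have hVi : Integrable (Q[L | m]) Q := integrable_condExp
  have hneg : Q.map (Q[L | m]) (Iio 0) = 0 := by
    rw [ae_nonneg_of_map_Iio hV]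
    -- `A` is a fixed event in `m`, so `∫_A L ≥ 0` holds on `𝓜` and passes to `Q`. There `Q[L | m]`
    -- is negative on `A`, so `A` is null.
    set A : Set Ω := (Q[L | m]) ⁻¹' Iio 0 with hA
    have hAm : MeasurableSet[m] A := hVm measurableSet_Iio
    have hA' : MeasurableSet A := hm A hAm
    have h1 := (hQ (fun ω => -A.indicator L ω) M 0 (hL.indicator hA').neg hM fun P hP => by
      have := hprob P hP
      have hLP : Integrable L P := (memLp_two_of_lintegral_le hL.aestronglyMeasurable hM
        (hLM P hP)).integrable (by norm_num)
      constructor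
      · refine (lintegral_mono fun ω => ?_).trans (hLM P hP)
        by_cases hω : ω ∈ A <;> simp [hω]
      · have hVP : Measurable (P[L | m]) := (stronglyMeasurable_condExp.mono hm).measurable
        rw [integral_neg, integral_indicator hA', ← setIntegral_condExp hm hLP hAm, neg_nonpos]
        exact setIntegral_nonneg_of_ae ((ae_nonneg_of_map_Iio hVP).1 (h P hP).1)).2
    rw [integral_neg, integral_indicator hA', ← setIntegral_condExp hm hLQ hAm, neg_nonpos,
      ← integral_indicator hA'] at h1
    have hle : ∀ ω, 0 ≤ -A.indicator (Q[L | m]) ω := fun ω => by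
      by_cases hω : ω ∈ A
      · have : (Q[L | m]) ω < 0 := hω
        simp only [indicator_of_mem hω]
        linarith
      · simp [hω]
    have h2 : ∫ ω, -A.indicator (Q[L | m]) ω ∂Q = 0 :=
      le_antisymm (by rw [integral_neg]; linarith) (integral_nonneg hle)
    rw [integral_eq_zero_iff_of_nonneg hle (hVi.indicator hA').neg] at h2
    filter_upwards [h2] with ω hω
    by_contra hlt
    have hmem : ω ∈ A := not_le.1 hlt
    simp only [indicator_of_mem hmem, Pi.zero_apply] at hω
    linarith
  refine convexOrderLB_of_affineMax hneg hμ0 fun a b n ha hb => ?_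
  rw [setLIntegral_Ici_map hV hneg (measurable_affineMax a b n).ennreal_ofReal]
  classical
  -- The least maximising index at `Q[L | m]`: optimal under `Q`, merely an `m`-measurable selection
  -- under the measures of `𝓜`.
  let τ : Ω → ℕ := fun ω => Nat.find (exists_eq_affineMax a b n ((Q[L | m]) ω))
  have hτ : Measurable[m] τ := by
    refine @measurable_find Ω m _ _ _ fun k => ?_
    refine MeasurableSet.inter (MeasurableSet.const _) ?_
    exact measurableSet_eq_fun (by fun_prop) ((measurable_affineMax a b n).comp hVm)
  have hspec : ∀ ω, τ ω ≤ n ∧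
      a (τ ω) + b (τ ω) * (Q[L | m]) ω = affineMax a b n ((Q[L | m]) ω) := fun ω =>
    Nat.find_spec (exists_eq_affineMax a b n ((Q[L | m]) ω))
  obtain ⟨hi, heq⟩ := integral_selected_affine_condExp hm hLQ a b hτ fun ω => (hspec ω).1
  have hmeas : ∀ c : ℕ → ℝ, Measurable fun ω => c (τ ω) := fun c =>
    (measurable_of_countable c).comp (hτ.mono hm le_rfl)
  set A := ∑ j ∈ Finset.range (n + 1), |a j|
  set B := ∑ j ∈ Finset.range (n + 1), |b j|
  have h1 := (hQ (fun ω => a (τ ω) + b (τ ω) * L ω) (2 * (‖A‖ₑ ^ 2 + ‖B‖ₑ ^ 2 * M))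
    (∫⁻ x in Ici 0, ENNReal.ofReal (affineMax a b n x) ∂μ).toReal
    ((hmeas a).add ((hmeas b).mul hL)) (by finiteness) fun P hP => by
      have := hprob P hP
      have hLP : Integrable L P := (memLp_two_of_lintegral_le hL.aestronglyMeasurable hM
        (hLM P hP)).integrable (by norm_num)
      refine ⟨?_, integral_selected_affine_le hm hLP hμ (h P hP) ha hb hτ fun ω => (hspec ω).1⟩
      refine lintegral_enorm_sq_le_of_abs_le (A := fun _ => A) (B := fun ω => B * L ω)
        measurable_const (fun ω => ?_) (by simp) ?_
      · refine (abs_add_le _ _).trans (add_le_add ?_ ?_)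
        · exact (abs_le_sum_of_le a (hspec ω).1).trans (le_abs_self _)
        · rw [abs_mul, abs_mul]
          exact mul_le_mul_of_nonneg_right
            ((abs_le_sum_of_le b (hspec ω).1).trans (le_abs_self _)) (abs_nonneg _)
      · simp only [enorm_mul, mul_pow]
        rw [lintegral_const_mul _ (by fun_prop)]
        gcongr
        exact hLM P hP).2
  rw [heq] at h1
  simp_rw [← (hspec _).2]
  rw [← ofReal_integral_eq_lintegral_ofReal hi (ae_of_all _ fun ω => by
    exact (affineMax_nonneg ha hb n _).trans_eq (hspec ω).2.symm)]
  exact ENNReal.ofReal_le_of_le_toReal h1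

end SchroedingerBridge

/-! ### Stability of the calibration and VIX constraints -/

namespace SchroedingerBridge

open scoped Topology

variable {Ω : Type*} [mΩ : MeasurableSpace Ω]

lemma lintegral_enorm_sq_of_hasLaw {P : Measure Ω} {Z : Ω → ℝ} {μ : Measure ℝ}
    (hZ : HasLaw Z μ P) {f : ℝ → ℝ} (hf : Measurable f) :
    ∫⁻ ω, ‖f (Z ω)‖ₑ ^ 2 ∂P = ∫⁻ z, ‖f z‖ₑ ^ 2 ∂μ := by
  rw [← hZ.map_eq, lintegral_map' (by fun_prop) hZ.aemeasurable]

lemma lintegral_enorm_sq_ne_top {μ : Measure ℝ} (hμ : MemLp id 2 μ) :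
    ∫⁻ z, ‖z‖ₑ ^ 2 ∂μ ≠ ∞ := by
  have h := (eLpNorm_lt_top_iff_lintegral_rpow_enorm_lt_top (by norm_num) (by norm_num)).1 hμ.2
  simpa using h.ne

/-- The calibration constraints are moment constraints. -/
lemma calibrated_of_satisfiesMoments {𝓕 : Filtration ℝ≥0 mΩ} {X : ℝ≥0 → Ω → ℝ} {t₀ T₁ T₂ : ℝ≥0}
    {μ₁ μ₂ : Measure ℝ} [IsProbabilityMeasure μ₁] [IsProbabilityMeasure μ₂]
    {𝓜 : Set (Measure Ω)} {Q : Measure Ω} [hQprob : IsProbabilityMeasure Q]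
    (hQ : SatisfiesMoments 𝓜 Q) (hprob : ∀ P ∈ 𝓜, IsProbabilityMeasure P)
    (hX : ∀ t ∈ Icc t₀ T₂, StronglyMeasurable[𝓕 t] (X t)) (hT₁ : T₁ ∈ Icc t₀ T₂)
    (hμ₂ : MemLp id 2 μ₂) (h : ∀ P ∈ 𝓜, P ∈ calibrated 𝓕 X t₀ T₁ T₂ μ₁ μ₂) :
    Q ∈ calibrated 𝓕 X t₀ T₁ T₂ μ₁ μ₂ := by
  have hmeas : ∀ t ∈ Icc t₀ T₂, Measurable (X t) := fun t ht =>
    ((hX t ht).mono (𝓕.le t)).measurable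
  have hT₂ : T₂ ∈ Icc t₀ T₂ := ⟨hT₁.1.trans hT₁.2, le_rfl⟩
  refine ⟨hQprob, fun ht => hQ.hasLaw hprob (hmeas T₁ hT₁) fun P hP => (h P hP).2.1 ht,
    hQ.hasLaw hprob (hmeas T₂ hT₂) fun P hP => (h P hP).2.2.1,
    hQ.martingale hprob (fun t => hX t t.2) (fun P hP => (h P hP).2.2.2)
      (lintegral_enorm_sq_ne_top hμ₂) fun P hP t => ?_⟩
  obtain ⟨_, -, hlaw, hmart⟩ := h P hP
  -- By conditional Jensen, the second moment of `μ₂` bounds `X t` uniformly in `t` and `P`.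
  have hcond := hmart.2 t ⟨T₂, hT₂⟩ t.2.2
  calc ∫⁻ ω, ‖X t ω‖ₑ ^ 2 ∂P
      = ∫⁻ ω, ‖(P[X T₂ | restrictIcc 𝓕 t₀ T₂ t]) ω‖ₑ ^ 2 ∂P :=
        lintegral_congr_ae (hcond.mono fun ω hω => by simp only [← hω])
    _ ≤ ∫⁻ ω, ‖X T₂ ω‖ₑ ^ 2 ∂P := lintegral_enorm_sq_condExp_le P _ _
    _ = ∫⁻ z, ‖z‖ₑ ^ 2 ∂μ₂ := lintegral_enorm_sq_of_hasLaw hlaw measurable_id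

lemma lintegral_enorm_log_sq_le {P : Measure Ω} {Z : Ω → ℝ} {μ : Measure ℝ}
    (hZ : HasLaw Z μ P) (hpos : ∀ᵐ ω ∂P, 0 < Z ω) :
    ∫⁻ ω, ‖Real.log (Z ω)‖ₑ ^ 2 ∂P = ∫⁻ z in Ioi 0, ‖Real.log z‖ₑ ^ 2 ∂μ := by
  rw [lintegral_enorm_sq_of_hasLaw hZ Real.measurable_log, Measure.restrict_eq_self_of_ae_mem]
  rw [← hZ.map_eq]
  exact (ae_map_iff hZ.aemeasurable measurableSet_Ioi).2 hpos

lemma ae_pos_of_hasLaw {P Q : Measure Ω} {Z : Ω → ℝ} {μ : Measure ℝ} (hP : HasLaw Z μ P)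
    (hQ : HasLaw Z μ Q) (hpos : ∀ᵐ ω ∂P, 0 < Z ω) : ∀ᵐ ω ∂Q, 0 < Z ω := by
  rw [← ae_map_iff (p := fun z => 0 < z) hP.aemeasurable measurableSet_Ioi, hP.map_eq] at hpos
  rwa [← ae_map_iff (p := fun z => 0 < z) hQ.aemeasurable measurableSet_Ioi, hQ.map_eq]

/-- The relaxed VIX constraint is a moment constraint. -/
lemma vixConstraint_of_satisfiesMoments {𝓕 : Filtration ℝ≥0 mΩ} {X : ℝ≥0 → Ω → ℝ}
    {t₀ T₁ T₂ : ℝ≥0} {μ₁ μ₂ μ₃ : Measure ℝ} [IsFiniteMeasure μ₃] {P₀ : Measure Ω} {x : ℝ}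
    {𝓜 : Set (Measure Ω)} {Q : Measure Ω} [IsProbabilityMeasure Q]
    (hQ : SatisfiesMoments 𝓜 Q) (hprob : ∀ P ∈ 𝓜, IsProbabilityMeasure P) (hQac : Q ≪ P₀)
    (ht₀ : t₀ ≤ T₁) (hT : T₁ < T₂) (hx : 0 < x)
    (hX : ∀ t ∈ Icc t₀ T₂, StronglyMeasurable[𝓕 t] (X t))
    (hinit : ∀ P : Measure Ω, P ≪ P₀ → ∀ᵐ ω ∂P, X t₀ ω = x)
    (hlog : IntegrableOn (fun z => Real.log z ^ 2) (Ioi 0) (μ₁ + μ₂))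
    (hμ₃ : Integrable id μ₃) (hμ₃_supp : μ₃ (Iio 0) = 0)
    (hcal : Q ∈ calibrated 𝓕 X t₀ T₁ T₂ μ₁ μ₂) (hne : 𝓜.Nonempty)
    (h : ∀ P ∈ 𝓜, P ∈ calibrated 𝓕 X t₀ T₁ T₂ μ₁ μ₂ ∩ vixConstraint 𝓕 X T₁ T₂ μ₃ ∧ P ≪ P₀) :
    Q ∈ vixConstraint 𝓕 X T₁ T₂ μ₃ := by
  have hmeas : ∀ t ∈ Icc t₀ T₂, Measurable (X t) := fun t ht =>
    ((hX t ht).mono (𝓕.le t)).measurable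
  have hX₁ : Measurable (X T₁) := hmeas T₁ ⟨ht₀, hT.le⟩
  have hX₂ : Measurable (X T₂) := hmeas T₂ ⟨ht₀.trans hT.le, le_rfl⟩
  have hL : Measurable fun ω => -Real.log (X T₂ ω) + Real.log (X T₁ ω) := by fun_prop
  have hlogtop : ∫⁻ z in Ioi 0, ‖Real.log z‖ₑ ^ 2 ∂(μ₁ + μ₂) ≠ ∞ := by
    have := hlog.2.ne
    simpa only [enorm_pow] using this
  rw [Measure.restrict_add, lintegral_add_measure] at hlogtop
  obtain ⟨hM₁, hM₂⟩ := ENNReal.add_ne_top.1 hlogtop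
  set M₁ := ∫⁻ z in Ioi 0, ‖Real.log z‖ₑ ^ 2 ∂μ₁
  set M₂ := ∫⁻ z in Ioi 0, ‖Real.log z‖ₑ ^ 2 ∂μ₂
  -- The term in `log x` covers `t₀ = T₁`, where no law is prescribed at `T₁` but `X T₁ = x` almost
  -- surely.
  set M := 2 * (M₂ + (M₁ + ‖Real.log x‖ₑ ^ 2))
  have hM : M ≠ ∞ := by finiteness
  have hLM : ∀ P ∈ 𝓜, ∫⁻ ω, ‖-Real.log (X T₂ ω) + Real.log (X T₁ ω)‖ₑ ^ 2 ∂P ≤ M := by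
    intro P hP
    have := hprob P hP
    obtain ⟨⟨⟨-, hlaw₁, hlaw₂, -⟩, hpos, -, -⟩, hPac⟩ := h P hP
    refine lintegral_enorm_sq_le_of_abs_le hX₂.log (fun ω => ?_)
      (lintegral_enorm_log_sq_le hlaw₂ (hpos.mono fun ω hω => hω.2)).le
      (B := fun ω => Real.log (X T₁ ω)) ?_
    · simpa using abs_add_le (-Real.log (X T₂ ω)) (Real.log (X T₁ ω))
    · rcases ht₀.lt_or_eq with hlt | rfl
      · exact (lintegral_enorm_log_sq_le (hlaw₁ hlt) (hpos.mono fun ω hω => hω.1)).le.trans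
          le_self_add
      · rw [lintegral_congr_ae ((hinit P hPac).mono fun ω hω =>
          (by simp only [hω] : ‖Real.log (X t₀ ω)‖ₑ ^ 2 = ‖Real.log x‖ₑ ^ 2))]
        simp
  refine ⟨?_, ?_, ?_⟩
  · obtain ⟨P, hP⟩ := hne
    obtain ⟨⟨⟨-, hlaw₁, hlaw₂, -⟩, hpos, -, -⟩, -⟩ := h P hP
    refine Eventually.and ?_ (ae_pos_of_hasLaw hlaw₂ hcal.2.2.1 (hpos.mono fun ω hω => hω.2))
    rcases ht₀.lt_or_eq with hlt | rfl
    · exact ae_pos_of_hasLaw (hlaw₁ hlt) (hcal.2.1 hlt) (hpos.mono fun ω hω => hω.1)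
    · exact (hinit Q hQac).mono fun ω hω => hω ▸ hx
  · exact (memLp_two_of_lintegral_le hL.aestronglyMeasurable hM
      (hQ.lintegral_le hprob hL hM hLM)).integrable (by norm_num)
  · exact hQ.convexOrderLB_condExp hprob (𝓕.le T₁) hL hM hLM hμ₃ hμ₃_supp
      fun P hP => (h P hP).1.2.2.2

end SchroedingerBridge

/-! ### Existence of the minimiser -/

open SchroedingerBridge
theorem proposition4p2
    -- the filtered probability space and the times
    {Ω : Type*} [mΩ : MeasurableSpace Ω] (𝓕 : Filtration ℝ≥0 mΩ)
    (P₀ : Measure Ω) [IsProbabilityMeasure P₀]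
    (t₀ T₁ T₂ : ℝ≥0) (ht₀ : t₀ ≤ T₁) (hT₁ : 0 < T₁) (hT : T₁ < T₂)
    -- the coefficients
    (σt : ℝ → ℝ) (b τ₁ τ₂ : ℝ × ℝ → ℝ)
    (hA3 : AssumptionA3 σt b τ₁ τ₂) (hA4 : AssumptionA4 σt b)
    -- the stochastic volatility model
    (W W' X Y : ℝ≥0 → Ω → ℝ) (x y : ℝ) (hx : 0 < x) (hy : 0 < y)
    (hSVM : SolvesSVM 𝓕 P₀ σt b τ₁ τ₂ W W' X Y t₀ T₂ x y)
    -- the prescribed laws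
    (μ₁ μ₂ μ₃ : Measure ℝ)
    [IsProbabilityMeasure μ₁] [IsProbabilityMeasure μ₂] [IsProbabilityMeasure μ₃]
    (hμ₁ : MemLp id 2 μ₁) (hμ₂ : MemLp id 2 μ₂) (hμ₃ : MemLp id 2 μ₃)
    (hμ₃_supp : μ₃ (Iio 0) = 0)
    (hμ₁₂ : ConvexOrder μ₁ μ₂)
    (hlog : IntegrableOn (fun z => Real.log z ^ 2) (Ioi 0) (μ₁ + μ₂))
    -- the problem is admissible
    (hadm : (calibrated 𝓕 X t₀ T₁ T₂ μ₁ μ₂ ∩ vixConstraint 𝓕 X T₁ T₂ μ₃).Nonempty) :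
    ∃ Pstar ∈ calibrated 𝓕 X t₀ T₁ T₂ μ₁ μ₂, Pstar ∈ vixConstraint 𝓕 X T₁ T₂ μ₃ ∧
      klDiv Pstar P₀ = relaxedValue 𝓕 P₀ X t₀ T₁ T₂ μ₁ μ₂ μ₃ := by
  by_cases hfin : ∃ P ∈ calibrated 𝓕 X t₀ T₁ T₂ μ₁ μ₂ ∩ vixConstraint 𝓕 X T₁ T₂ μ₃, klDiv P P₀ ≠ ∞
  -- If every admissible measure has infinite entropy, the infimum is `∞` and any of them attains
  -- it.
  swap
  · push Not at hfin
    obtain ⟨P, hP⟩ := hadm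
    refine ⟨P, hP.1, hP.2, ?_⟩
    rw [hfin P hP, relaxedValue]
    exact (iInf₂_eq_top.2 hfin).symm
  -- Finite entropy forces `P ≪ P₀`, which carries the initial condition `X t₀ = x` over to `P`.
  set 𝓜 : Set (Measure Ω) := {P | P ∈ calibrated 𝓕 X t₀ T₁ T₂ μ₁ μ₂ ∩ vixConstraint 𝓕 X T₁ T₂ μ₃ ∧
    klDiv P P₀ ≠ ∞} with h𝓜
  have hprob : ∀ P ∈ 𝓜, IsProbabilityMeasure P := fun P hP => hP.1.1.1
  obtain ⟨P', hP', hP'fin⟩ := hfin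
  obtain ⟨Q, hQprob, hQac, hQmin, hQ⟩ := exists_entropic_projection P₀ (𝓜 := 𝓜) ⟨P', hP', hP'fin⟩ hprob
    fun P hP => hP.2
  have hinit : ∀ P : Measure Ω, P ≪ P₀ → ∀ᵐ ω ∂P, X t₀ ω = x := fun P hP =>
    hP.ae_le (hSVM.initial.mono fun ω h => h.1)
  have hcal : Q ∈ calibrated 𝓕 X t₀ T₁ T₂ μ₁ μ₂ := calibrated_of_satisfiesMoments hQ hprob
    (fun t ht => (hSVM.adapted t ht).1) ⟨ht₀, hT.le⟩ hμ₂ fun P hP => hP.1.1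
  have hvix := vixConstraint_of_satisfiesMoments hQ hprob hQac ht₀ hT hx
    (fun t ht => (hSVM.adapted t ht).1) hinit hlog (hμ₃.integrable (by norm_num)) hμ₃_supp hcal
    ⟨P', hP', hP'fin⟩ fun P hP => ⟨hP.1, (klDiv_ne_top_iff.1 hP.2).1⟩
  refine ⟨Q, hcal, hvix, le_antisymm (le_iInf₂ fun P hP => ?_) (iInf₂_le Q ⟨hcal, hvix⟩)⟩
  by_cases hPtop : klDiv P P₀ = ∞
  · simp [hPtop]
  · exact hQmin P ⟨hP, hPtop⟩
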